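/- Let $R$ be a real closed field and let $V$ be an affine $R$-variety, i.e. an affine, reduced scheme of finite type over $\operatorname{Spec} R$, not necessarily irreducible, with coordinate ring $R[V]=\mathcal{O}_V(V)$ and set of real points $V(R)$ (the $R$-valued points over $R$, also viewed as a subset of $V$). For an affine $R$-variety $W$, say that psd$=$sos in $R[W]$ if every $f\in R[W]$ with $f(P)\ge 0$ for all $P\in W(R)$ is a sum of squares of elements of $R[W]$. An irreducible component $Z$ of $V$ is called real if $Z(R)=Z\cap V(R)$ is Zariski-dense in $Z$, and non-real otherwise. Let $V_r$ be the union of all real irreducible components of $V$ and $V_{nr}$ the union of all non-real irreducible components of $V$, both regarded as (possibly empty) closed subvarieties of $V$ with the reduced scheme structure. Then psd$=$sos in $R[V]$ if and only if the following three conditions all hold: $V_{nr}(R)=\emptyset$; $V_r\cap V_{nr}=\emptyset$; and psd$=$sos in $R[V_r]$. -/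

import Mathlib

open CategoryTheory AlgebraicGeometry

universe u

noncomputable section

namespace RealVariety

/-- A variety over a field `k`: a reduced separated scheme of finite type over `Spec k`,
not necessarily irreducible. -/
class IsVariety {k : Type u} [Field k] {V : Scheme.{u}} (π : V ⟶ Spec (.of k)) : Prop where
  isReduced : IsReduced V
  isSeparated : IsSeparated π
  locallyOfFiniteType : LocallyOfFiniteType π
  quasiCompact : QuasiCompact π

/-- The set `V(k)` of `k`-valued points of a scheme `V` over `k`: the sections of its
structure morphism. -/
def Points {k : Type u} [Field k] {V : Scheme.{u}} (π : V ⟶ Spec (.of k)) : Type u :=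
  { P : Spec (.of k) ⟶ V // P ≫ π = 𝟙 (Spec (.of k)) }

variable {k : Type u} [Field k] {V : Scheme.{u}} {π : V ⟶ Spec (.of k)}

/-- The point of the underlying space of `V` given by a `k`-valued point. -/
def Points.toSpace (P : Points π) : V :=
  P.1 (IsLocalRing.closedPoint k)

/-- The value `f(P)` of a regular function `f` on `V` at a `k`-valued point `P`: the pullback
of `f` along `P`, an element of `Γ(Spec k, ⊤) = k`. -/
def Points.eval (P : Points π) (f : Γ(V, ⊤)) : k :=
  (Scheme.ΓSpecIso (.of k)).hom (P.1.appTop f)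

variable (π)

/-- `V(k)`, viewed as a subset of the underlying space of `V`. -/
def rationalPoints : Set V := Set.range (Points.toSpace (π := π))

/-- psd = sos in `R[V]`: every regular function on `V` that is nonnegative at all points of `V(R)`
is a sum of squares of regular functions on `V`. -/
def PsdEqSos {R : Type u} [Field R] [LinearOrder R] {V : Scheme.{u}}
    (π : V ⟶ Spec (.of R)) : Prop :=
  ∀ f : Γ(V, ⊤), (∀ P : Points π, 0 ≤ P.eval f) → IsSumSq f

/-- A closed subvariety `Z` of `V` is called real if `Z(R)` is Zariski-dense in `Z`. -/
def IsRealSubset (Z : Set V) : Prop := Z ⊆ closure (Z ∩ rationalPoints π)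

/-- The union of all irreducible components of `V` that are real, as a set. -/
def realPart : Set V :=
  ⋃₀ { Z | Z ∈ irreducibleComponents V ∧ IsRealSubset π Z }

/-- The union of all irreducible components of `V` that are not real, as a set. -/
def nonrealPart : Set V :=
  ⋃₀ { Z | Z ∈ irreducibleComponents V ∧ ¬ IsRealSubset π Z }

theorem isClosed_realPart [IsVariety π] : IsClosed (realPart π) := by
  have h1 : LocallyOfFiniteType π := IsVariety.locallyOfFiniteType
  have h2 : QuasiCompact π := IsVariety.quasiCompact
  have h3 : IsLocallyNoetherian V := LocallyOfFiniteType.isLocallyNoetherian π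
  have h4 : CompactSpace V := QuasiCompact.compactSpace_of_compactSpace π
  have h5 : IsNoetherian V := { }
  rw [realPart, Set.sUnion_eq_biUnion]
  refine Set.Finite.isClosed_biUnion ?_ fun Z hZ => isClosed_of_mem_irreducibleComponents Z hZ.1
  exact TopologicalSpace.NoetherianSpace.finite_irreducibleComponents.subset fun Z hZ => hZ.1

/-- `V_r`, the union of all real irreducible components of `V`, as a closed subvariety of `V`,
that is, with its structure of a reduced closed subscheme. -/
def realSubvariety [IsVariety π] : Scheme.{u} :=
  (Scheme.IdealSheafData.vanishingIdeal ⟨realPart π, isClosed_realPart π⟩).subscheme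

/-- The structure morphism of `V_r`, the restriction of that of `V`. -/
def realSubvarietyStr [IsVariety π] : realSubvariety π ⟶ Spec (.of k) :=
  (Scheme.IdealSheafData.vanishingIdeal ⟨realPart π, isClosed_realPart π⟩).subschemeι ≫ π

end RealVariety

end

/-! ### Semireal fields and the intermediate value property. -/

section RealFields

open Polynomial

/-! Suppose psd = sos, and let I be the ideal of functions vanishing on V(R). Each f in I is psd, so
f is a sum of squares, and every function squared in it again vanishes on V(R); hence I = I². As
R[V] is noetherian, I is generated by an idempotent, so the closure of V(R) is clopen. It contains
or misses each component, and a component inside it is real because it contains a nonempty open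
subset of V. So V_r is this closure and V_nr its complement. All of V(R) lies on V_r, and functions
on V_r lift to V, so psd = sos passes to V_r.

Conversely, when V_r and V_nr are disjoint, an idempotent splits R[V] into two factors. The factor
of V_nr has no R-point, so -1 is a sum of squares there, and f = ((f+1)/2)² - ((f-1)/2)² makes every
element one (`IsIdempotentElem.isSumSq`).

The last step needs the weak real Nullstellensatz `IsRealClosed.isSumSq_neg_one_of_isEmpty`. If -1
is not a sum of squares in A, then A maps to a semireal field, hence to an ordered field S with
polynomial intermediate values. The Artin-Lang theorem `IsRealClosed.nonempty_algHom` moves this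
point to R, adjoining one element t of S at a time to a subfield F algebraically closed in S: F(t),
and then its algebraic closure in S, embeds in an ultrapower of F, and a finitely presented algebra
with a point in an ultrapower of F has one in F. -/

theorem IsSumSq.map_ringHom {A B : Type*} [CommRing A] [CommRing B] {s : A} (hs : IsSumSq s)
    (φ : A →+* B) : IsSumSq (φ s) := by
  induction hs with
  | zero => simp
  | sq_add a _ ih => rw [map_add, map_mul]; exact .sq_add _ ih

theorem IsSemireal.of_ringHom {A B : Type*} [CommRing A] [CommRing B] [IsSemireal B]
    (φ : A →+* B) : IsSemireal A where
  one_add_ne_zero hs h := IsSemireal.one_add_ne_zero (hs.map_ringHom φ) (by simpa using congrArg φ h)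

/-- The intermediate value property for polynomials over an ordered field. -/
def HasPolynomialIVT (K : Type*) [Field K] [LinearOrder K] : Prop :=
  ∀ (f : K[X]) (a b : K), a ≤ b → f.eval a ≤ 0 → 0 ≤ f.eval b →
    ∃ c, a ≤ c ∧ c ≤ b ∧ f.eval c = 0

/-- A field without proper finite simple extensions in which `-1` is not a sum of squares. -/
def HasNoSemirealExtension (K : Type*) [Field K] : Prop :=
  ∀ f : K[X], Irreducible f → IsSemireal (AdjoinRoot f) → f.natDegree = 1

/-- Each summand is reduced modulo `f` before squaring. The degree bound forces the cofactor of `f`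
in `1 + p` to have smaller degree than `f`. -/
theorem AdjoinRoot.exists_isSumSq_lift {K : Type*} [Field K] {f : K[X]} (hf : 0 < f.natDegree)
    {s : AdjoinRoot f} (hs : IsSumSq s) :
    ∃ p : K[X], IsSumSq p ∧ AdjoinRoot.mk f p = s ∧ p.natDegree ≤ 2 * (f.natDegree - 1) := by
  induction hs with
  | zero => exact ⟨0, .zero, by simp, by simp⟩
  | @sq_add a s _ ih =>
    obtain ⟨p, hp, rfl, hd⟩ := ih
    obtain ⟨g, rfl⟩ := AdjoinRoot.mk_surjective a
    refine ⟨(g % f) * (g % f) + p, .sq_add _ hp, ?_, ?_⟩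
    · have : AdjoinRoot.mk f (g % f) = AdjoinRoot.mk f g := by
        conv_rhs => rw [← EuclideanDomain.mod_add_div g f]
        simp
      simp [this]
    · have h1 : (g % f).natDegree < f.natDegree := natDegree_mod_lt g hf.ne'
      refine (natDegree_add_le _ _).trans (max_le (natDegree_mul_le.trans ?_) hd)
      omega

/-- Induction on the degree. If `f` factors, some factor changes sign. If `f` is irreducible and not
linear, then `-1` is a sum of squares modulo `f`, so `1 + p = f * q` with `p` a sum of squares; `q`
has the same signs as `f` and smaller degree, and its root contradicts `1 + p > 0`. -/
theorem HasNoSemirealExtension.hasPolynomialIVT {K : Type*} [Field K] [LinearOrder K]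
    [IsStrictOrderedRing K] (hK : HasNoSemirealExtension K) : HasPolynomialIVT K := by
  intro f
  induction h : f.natDegree using Nat.strong_induction_on generalizing f with
  | h n ih =>
  subst h
  intro a b hab ha hb
  rcases ha.eq_or_lt with ha | ha
  · exact ⟨a, le_rfl, hab, ha⟩
  rcases hb.eq_or_lt with hb | hb
  · exact ⟨b, hab, le_rfl, hb.symm⟩
  have hf0 : f ≠ 0 := by rintro rfl; simp at ha
  have hdeg : 0 < f.natDegree := by
    rw [Nat.pos_iff_ne_zero]
    intro h0
    rw [eq_C_of_natDegree_eq_zero h0] at ha hb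
    simp only [eval_C] at ha hb
    exact ha.asymm hb
  have key : ∀ g : K[X], g.natDegree < f.natDegree → g.eval a * g.eval b < 0 →
      ∃ c, a ≤ c ∧ c ≤ b ∧ g.eval c = 0 := by
    intro g hg hlt
    rcases mul_neg_iff.mp hlt with ⟨h1, h2⟩ | ⟨h1, h2⟩
    · obtain ⟨c, h3, h4, h5⟩ := ih (-g).natDegree (by simpa using hg) (-g) rfl a b hab
        (by simpa using h1.le) (by simpa using h2.le)
      exact ⟨c, h3, h4, by simpa using h5⟩
    · exact ih g.natDegree hg g rfl a b hab h1.le h2.le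
  by_cases hirr : Irreducible f
  · by_cases hsr : IsSemireal (AdjoinRoot f)
    · have h1 := hK f hirr hsr
      obtain ⟨k, m, rfl⟩ : ∃ k m, f = C k * X + C m :=
        ⟨_, _, eq_X_add_C_of_natDegree_le_one h1.le⟩
      simp only [eval_add, eval_mul, eval_C, eval_X] at ha hb
      have hk : 0 < k := by
        by_contra hk
        have := mul_nonneg (neg_nonneg.mpr (not_lt.mp hk)) (sub_nonneg.mpr hab)
        nlinarith
      refine ⟨-m / k, ?_, ?_, ?_⟩
      · rw [le_div_iff₀ hk]; linarith
      · rw [div_le_iff₀ hk]; linarith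
      · simp; field_simp; ring
    · exfalso
      rw [isSemireal_iff_not_isSumSq_neg_one, not_not] at hsr
      obtain ⟨p, hp, hp1, hpd⟩ := AdjoinRoot.exists_isSumSq_lift hdeg hsr
      have hdvd : f ∣ 1 + p := by
        rw [← AdjoinRoot.mk_eq_zero]; simp [hp1]
      obtain ⟨q, hq⟩ := hdvd
      have hpos : ∀ c, 0 < f.eval c * q.eval c := by
        intro c
        rw [← eval_mul, ← hq, eval_add, eval_one]
        have := (hp.map_ringHom (evalRingHom c)).nonneg
        simp only [coe_evalRingHom] at this
        linarith
      have hq0 : q ≠ 0 := by rintro rfl; simpa using hpos a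
      have hqd : q.natDegree < f.natDegree := by
        have h1 := congrArg natDegree hq
        rw [natDegree_mul hf0 hq0] at h1
        have h2 := natDegree_add_le 1 p
        simp only [natDegree_one] at h2
        omega
      have hqa : q.eval a < 0 := by
        by_contra h
        exact absurd (hpos a) (not_lt.mpr (mul_nonpos_of_nonpos_of_nonneg ha.le (not_lt.mp h)))
      have hqb : 0 < q.eval b := pos_of_mul_pos_right (hpos b) hb.le
      obtain ⟨c, -, -, hc⟩ := key q hqd (mul_neg_of_neg_of_pos hqa hqb)
      simpa [hc] using hpos c
  · have hnu : ¬ IsUnit f := fun h => hdeg.ne' (natDegree_eq_zero_of_isUnit h)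
    obtain ⟨g, k, hg, hk, rfl⟩ : ∃ g k, ¬ IsUnit g ∧ ¬ IsUnit k ∧ f = g * k := by
      rw [irreducible_iff] at hirr
      push Not at hirr
      obtain ⟨g, k, h1, h2, h3⟩ := hirr hnu
      exact ⟨g, k, h2, h3, h1⟩
    have hg0 : g ≠ 0 := left_ne_zero_of_mul hf0
    have hk0 : k ≠ 0 := right_ne_zero_of_mul hf0
    have hgd : 0 < g.natDegree := Nat.pos_of_ne_zero fun h => hg <|
      isUnit_iff_degree_eq_zero.mpr (by rw [degree_eq_natDegree hg0, h]; rfl)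
    have hkd : 0 < k.natDegree := Nat.pos_of_ne_zero fun h => hk <|
      isUnit_iff_degree_eq_zero.mpr (by rw [degree_eq_natDegree hk0, h]; rfl)
    rw [natDegree_mul hg0 hk0] at key
    rw [eval_mul] at ha hb
    rcases lt_or_ge (g.eval a * g.eval b) 0 with h | h
    · obtain ⟨c, h1, h2, h3⟩ := key g (by omega) h
      exact ⟨c, h1, h2, by simp [h3]⟩
    · have : k.eval a * k.eval b < 0 := by
        by_contra h'
        have h4 := mul_nonneg h (not_lt.mp h')
        have h5 := mul_neg_of_neg_of_pos ha hb
        have h6 : g.eval a * g.eval b * (k.eval a * k.eval b) =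
          g.eval a * k.eval a * (g.eval b * k.eval b) := by ring
        linarith
      obtain ⟨c, h1, h2, h3⟩ := key k (by omega) this
      exact ⟨c, h1, h2, by simp [h3]⟩

/-- A ring in which `-1` is not a sum of squares has a semireal residue field. -/
theorem exists_ringHom_semireal_field (A : Type u) [CommRing A] [IsSemireal A] :
    ∃ (k : Type u) (_ : Field k) (_ : A →+* k), IsSemireal k := by
  -- Once `M` is inverted, every residue field is semireal: clearing denominators in `1 + s = 0`
  -- would send some `u * u + t` in `M`, which has become a unit, to zero.
  let M : Submonoid A :=
    { carrier := {x | ∃ s, IsSumSq s ∧ x = 1 + s}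
      one_mem' := ⟨0, .zero, by simp⟩
      mul_mem' := by
        rintro _ _ ⟨s, hs, rfl⟩ ⟨t, ht, rfl⟩
        exact ⟨s + t + s * t, (hs.add ht).add (hs.mul ht), by ring⟩ }
  have h0 : (0 : A) ∉ M := fun ⟨s, hs, h⟩ => IsSemireal.one_add_ne_zero hs h.symm
  have hsq : ∀ u ∈ M, ∀ t : A, IsSumSq t → u * u + t ∈ M := by
    rintro u hu t ht
    obtain ⟨s, hs, hs'⟩ := M.mul_mem hu hu
    exact ⟨s + t, hs.add ht, by rw [hs']; ring⟩
  have : Nontrivial (Localization M) :=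
    ⟨⟨0, 1, fun h => h0 <| by
      obtain ⟨c, hc⟩ := (IsLocalization.eq_iff_exists M (Localization M) (x := 0) (y := 1)).mp
        (by simpa using h)
      have : (c : A) = 0 := by simpa using hc.symm
      exact this ▸ c.2⟩⟩
  obtain ⟨m, hm⟩ := Ideal.exists_maximal (Localization M)
  let := Ideal.Quotient.field m
  let φ : A →+* Localization M ⧸ m := (Ideal.Quotient.mk m).comp (algebraMap A (Localization M))
  have hunit : ∀ u ∈ M, φ u ≠ 0 := fun u hu =>
    ((IsLocalization.map_units (Localization M) (⟨u, hu⟩ : M)).map (Ideal.Quotient.mk m)).ne_zero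
  refine ⟨Localization M ⧸ m, inferInstance, φ, ⟨fun {s} hs h => ?_⟩⟩
  have : ∃ u ∈ M, ∃ t, IsSumSq t ∧ φ (u * u) * s = φ t := by
    clear h
    induction hs with
    | zero => exact ⟨1, M.one_mem, 0, .zero, by simp⟩
    | @sq_add a s _ ih =>
      obtain ⟨u, hu, t, ht, hut⟩ := ih
      obtain ⟨y, rfl⟩ := Ideal.Quotient.mk_surjective a
      obtain ⟨b, v, rfl⟩ := IsLocalization.exists_mk'_eq M y
      refine ⟨u * v, M.mul_mem hu v.2, (b * u) * (b * u) + (v * v) * t,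
        .sq_add _ ((IsSumSq.mul_self _).mul ht), ?_⟩
      have h1 : (Ideal.Quotient.mk m) (IsLocalization.mk' (Localization M) b v) * φ v = φ b := by
        simp only [φ, RingHom.comp_apply, ← map_mul, IsLocalization.mk'_spec]
      simp only [map_mul, map_add] at hut ⊢
      rw [← h1, ← hut]
      ring
  obtain ⟨u, hu, t, ht, hut⟩ := this
  refine hunit _ (hsq u hu t ht) ?_
  rw [map_add, ← hut, ← mul_one_add, h, mul_zero]

end RealFields

/-! ### Real closed fields and maximal semireal extensions. -/

section RealClosedFields

open Polynomial IntermediateField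

/-- Over a real closed field, a finite extension of odd degree is trivial. -/
theorem IsRealClosed.finrank_eq_one_of_odd {R N : Type*} [Field R] [IsRealClosed R] [Field N]
    [Algebra R N] [FiniteDimensional R N] (h : Odd (Module.finrank R N)) :
    Module.finrank R N = 1 := by
  obtain ⟨α, hα⟩ := Field.exists_primitive_element R N
  have hint : IsIntegral R α := .of_finite R α
  have hd : (minpoly R α).natDegree = Module.finrank R N := by
    rw [← adjoin.finrank hint, hα, finrank_top']
  obtain ⟨x, hx⟩ := IsRealClosed.exists_isRoot_of_odd_natDegree (hd ▸ h)
  rw [← hd]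
  exact natDegree_eq_of_degree_eq_some
    (degree_eq_one_of_irreducible_of_root (minpoly.irreducible hint) hx)

/-- A quadratic extension of a real closed field contains a square root of `-1`. -/
theorem IsRealClosed.not_isSemireal_of_finrank_eq_two {R N : Type*} [Field R] [IsRealClosed R]
    [Field N] [Algebra R N] (h : Module.finrank R N = 2) : ¬ IsSemireal N := by
  intro hN
  have : FiniteDimensional R N := Module.finite_of_finrank_pos (by omega)
  obtain ⟨α, hα⟩ := Field.exists_primitive_element R N
  have hint : IsIntegral R α := .of_finite R α
  have hd : (minpoly R α).natDegree = 2 := by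
    rw [← adjoin.finrank hint, hα, finrank_top', h]
  have hroot : ∀ x, algebraMap R N x ≠ α := by
    rintro x rfl
    rw [minpoly.eq_X_sub_C, natDegree_X_sub_C] at hd
    omega
  obtain ⟨b, c, hbc⟩ : ∃ b c : R, α ^ 2 + algebraMap R N b * α + algebraMap R N c = 0 := by
    have h1 := minpoly.aeval R α
    rw [aeval_eq_sum_range, hd, Finset.sum_range_succ, Finset.sum_range_succ,
      Finset.sum_range_one, ← hd, (minpoly.monic hint).coeff_natDegree, hd] at h1
    refine ⟨(minpoly R α).coeff 1, (minpoly R α).coeff 0, ?_⟩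
    simp only [Algebra.smul_def, map_one] at h1
    linear_combination h1
  have h2 : (2 : N) ≠ 0 := two_ne_zero
  have h2' : (2 : R) ≠ 0 := two_ne_zero
  -- Completing the square: `β * β` comes from `R`, where it or its negative is a square `s * s`. In
  -- the first case `α` lies in `R`; in the second `β / s` squares to `-1`.
  set β := α + algebraMap R N (b / 2) with hβ
  have hsq : β * β = algebraMap R N (b ^ 2 / 4 - c) := by
    have h4 : (4 : N) ≠ 0 := by norm_num
    simp only [hβ, map_div₀, map_sub, map_pow, map_ofNat]
    field_simp
    linear_combination 16 * hbc
  rcases IsRealClosed.isSquare_or_isSquare_neg (b ^ 2 / 4 - c) with ⟨s, hs⟩ | ⟨s, hs⟩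
  · rw [hs, map_mul, mul_self_eq_mul_self_iff] at hsq
    rcases hsq with h3 | h3
    · refine hroot (s - b / 2) ?_
      rw [map_sub, ← h3, hβ]; ring
    · refine hroot (-s - b / 2) ?_
      rw [map_sub, map_neg, ← h3, hβ]; ring
  · have h3 : β * β = - (algebraMap R N s * algebraMap R N s) := by
      rw [hsq, ← map_mul, ← hs]; simp
    have hs0 : algebraMap R N s ≠ 0 := by
      intro h0
      rw [h0, mul_zero, neg_zero, mul_self_eq_zero] at h3
      refine hroot (- (b / 2)) ?_
      rw [map_neg]
      linear_combination -h3
    refine IsSemireal.one_add_ne_zero (IsSumSq.mul_self (β / algebraMap R N s)) ?_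
    field_simp
    linear_combination h3

/-- The fixed field of a Sylow 2-subgroup has odd degree, so the Galois group is a 2-group. If `M ≠
⊥`, its fixing subgroup is proper and lies in a subgroup of index 2, whose fixed field is a
quadratic extension of `R` inside `M`. -/
theorem IsRealClosed.eq_bot_of_isSemireal {R N : Type*} [Field R] [IsRealClosed R] [Field N]
    [Algebra R N] [FiniteDimensional R N] [IsGalois R N] (M : IntermediateField R N)
    [IsSemireal M] : M = ⊥ := by
  have h2 : Fact (Nat.Prime 2) := ⟨Nat.prime_two⟩
  obtain ⟨P⟩ : Nonempty (Sylow 2 Gal(N/R)) := inferInstance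
  have hidx : ∀ H : Subgroup Gal(N/R), Module.finrank R (fixedField H) = H.index := fun H => by
    rw [finrank_eq_fixingSubgroup_index, fixingSubgroup_fixedField]
  have hP : (P : Subgroup Gal(N/R)).index = 1 := by
    rw [← hidx]
    refine finrank_eq_one_of_odd ?_
    rw [hidx, ← Nat.not_even_iff_odd, even_iff_two_dvd]
    exact P.not_dvd_index
  have hG : IsPGroup 2 Gal(N/R) := by
    have := P.isPGroup'
    rw [Subgroup.index_eq_one.mp hP] at this
    exact this.of_equiv Subgroup.topEquiv
  obtain ⟨m, hm⟩ := hG.exists_card_eq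
  obtain ⟨n, hn⟩ := (hG.to_subgroup M.fixingSubgroup).exists_card_eq
  have hmul := M.fixingSubgroup.card_mul_index
  by_contra hM
  have hnm : n < m := by
    by_contra hnm
    have h1 : 2 ^ m ≤ 2 ^ n := Nat.pow_le_pow_right (by norm_num) (not_lt.mp hnm)
    have h3 : M.fixingSubgroup.index = 1 := by
      rw [hn, hm] at hmul
      have h4 : 0 < M.fixingSubgroup.index := Nat.pos_of_ne_zero M.fixingSubgroup.index_ne_zero_of_finite
      have h5 : 0 < 2 ^ n := by positivity
      nlinarith
    rw [← finrank_eq_fixingSubgroup_index, IntermediateField.finrank_eq_one_iff] at h3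
    exact hM h3
  obtain ⟨K, hK, hle⟩ := Sylow.exists_subgroup_card_pow_prime_le 2 (m := m - 1)
    (hm ▸ pow_dvd_pow 2 (Nat.sub_le m 1)) M.fixingSubgroup hn (by omega)
  have hKi : K.index = 2 := by
    have h3 := K.card_mul_index
    rw [hK, hm] at h3
    have h4 : 2 ^ m = 2 ^ (m - 1) * 2 := by rw [← pow_succ]; congr 1; omega
    rw [h4] at h3
    exact Nat.eq_of_mul_eq_mul_left (by positivity) h3
  have hKM : fixedField K ≤ M := by
    rw [← IsGalois.fixedField_fixingSubgroup M]
    exact fixedField_antitone hle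
  exact not_isSemireal_of_finrank_eq_two ((hidx K).trans hKi)
    (IsSemireal.of_ringHom (inclusion hKM).toRingHom)

theorem IsRealClosed.hasNoSemirealExtension (R : Type*) [Field R] [IsRealClosed R] :
    HasNoSemirealExtension R := by
  intro f hf hs
  have : Fact (Irreducible f) := ⟨hf⟩
  have hfd : FiniteDimensional R (AdjoinRoot f) := (AdjoinRoot.powerBasis hf.ne_zero).finite
  let N := normalClosure R (AdjoinRoot f) (AlgebraicClosure (AdjoinRoot f))
  have : IsGalois R N := { }
  let φ : AdjoinRoot f →ₐ[R] N := IsScalarTower.toAlgHom R (AdjoinRoot f) N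
  let e : AdjoinRoot f ≃ₐ[R] φ.fieldRange := AlgEquiv.ofInjectiveField φ
  have : IsSemireal φ.fieldRange := IsSemireal.of_ringHom e.symm.toAlgHom.toRingHom
  have h1 := eq_bot_of_isSemireal φ.fieldRange
  rw [← AdjoinRoot.powerBasis_dim hf.ne_zero, ← PowerBasis.finrank, e.toLinearEquiv.finrank_eq,
    h1, IntermediateField.finrank_bot]

theorem nonempty_adjoin_algHom_adjoinRoot {K E : Type*} [Field K] [Field E] [Algebra K E]
    {f : K[X]} (hf : Irreducible f) {α : E} (hα : aeval α f = 0) :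
    Nonempty (K⟮α⟯ →ₐ[K] AdjoinRoot f) := by
  have : Fact (Irreducible f) := ⟨hf⟩
  have hint : IsIntegral K α := IsAlgebraic.isIntegral ⟨f, hf.ne_zero, hα⟩
  refine ⟨(algHomAdjoinIntegralEquiv K hint).symm ⟨AdjoinRoot.root f, ?_⟩⟩
  rw [mem_aroots]
  refine ⟨minpoly.ne_zero hint, ?_⟩
  rw [← minpoly.eq_of_irreducible hf hα]
  simp

/-- The sums of squares of a semireal field without semireal extensions form an ordering. -/
theorem HasNoSemirealExtension.isSumSq_or_isSumSq_neg {K : Type*} [Field K] [IsSemireal K]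
    (hK : HasNoSemirealExtension K) (a : K) : IsSumSq a ∨ IsSumSq (-a) := by
  by_cases ha : IsSquare a
  · exact .inl ha.isSumSq
  right
  have hd : (X ^ 2 - C a).natDegree = 2 := natDegree_X_pow_sub_C
  have hirr : Irreducible (X ^ 2 - C a) := by
    refine irreducible_of_degree_le_three_of_not_isRoot (by simp [hd]) fun x hx => ha ⟨x, ?_⟩
    simp only [IsRoot.def, eval_sub, eval_pow, eval_X, eval_C] at hx
    linear_combination -hx
  have hns : ¬ IsSemireal (AdjoinRoot (X ^ 2 - C a)) := fun h => by
    have := hK _ hirr h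
    omega
  rw [isSemireal_iff_not_isSumSq_neg_one, not_not] at hns
  set f : K[X] := X ^ 2 - C a with hf
  have hroot : AdjoinRoot.root f * AdjoinRoot.root f = AdjoinRoot.of f a := by
    have := AdjoinRoot.eval₂_root f
    simp only [hf, eval₂_sub, eval₂_X_pow, eval₂_C] at this
    linear_combination this
  -- The coefficient of `1` in a sum of squares of `K(√a)` is `p + a * q`. For the sum `-1` this
  -- gives `1 + p + a * q = 0`, that is, `-a = (1 + p) / q`.
  have key : ∀ s : AdjoinRoot f, IsSumSq s → ∃ p q w : K, IsSumSq p ∧ IsSumSq q ∧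
      s = AdjoinRoot.of f (p + a * q) + AdjoinRoot.of f w * AdjoinRoot.root f := by
    intro s hs
    induction hs with
    | zero => exact ⟨0, 0, 0, .zero, .zero, by simp⟩
    | @sq_add x s _ ih =>
      obtain ⟨p, q, w, hp, hq, rfl⟩ := ih
      obtain ⟨u, v, rfl⟩ : ∃ u v : K, x = AdjoinRoot.of f u + AdjoinRoot.of f v * AdjoinRoot.root f := by
        obtain ⟨g, rfl⟩ := AdjoinRoot.mk_surjective x
        have h1 : AdjoinRoot.mk f g = AdjoinRoot.mk f (g % f) := by
          conv_lhs => rw [← EuclideanDomain.mod_add_div g f]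
          simp
        have h2 : (g % f).natDegree ≤ 1 :=
          Nat.le_of_lt_succ ((natDegree_mod_lt g (by rw [hd]; norm_num)).trans_eq hd)
        refine ⟨(g % f).coeff 0, (g % f).coeff 1, ?_⟩
        rw [h1, eq_X_add_C_of_natDegree_le_one h2]
        simp [add_comm]
      refine ⟨u * u + p, v * v + q, 2 * u * v + w, .sq_add _ hp, .sq_add _ hq, ?_⟩
      simp only [map_add, map_mul, map_ofNat]
      linear_combination (AdjoinRoot.of f v) ^ 2 * hroot
  obtain ⟨p, q, w, hp, hq, h⟩ := key _ hns
  have h1 : AdjoinRoot.mk f (C w * X + C (1 + p + a * q)) = 0 := by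
    simp only [map_add, map_mul, AdjoinRoot.mk_C, AdjoinRoot.mk_X] at h ⊢
    simp only [map_one]
    linear_combination -h
  rw [AdjoinRoot.mk_eq_zero] at h1
  have h2 : C w * X + C (1 + p + a * q) = 0 := by
    refine eq_zero_of_dvd_of_natDegree_lt h1 ?_
    rw [hd]
    exact (natDegree_linear_le).trans_lt (by norm_num)
  have h3 : 1 + p + a * q = 0 := by simpa using congrArg (coeff · 0) h2
  have hq0 : q ≠ 0 := by
    rintro rfl
    exact IsSemireal.one_add_ne_zero hp (by simpa using h3)
  have h4 : -a = (1 + p) * q * (q⁻¹ * q⁻¹) := by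
    field_simp
    linear_combination -h3
  rw [h4]
  exact ((IsSumSq.one.add hp).mul hq).mul (IsSumSq.mul_self _)

/-- The positive cone consists of the sums of squares. If `a ≠ 0` and `-a` were both in it, so would
be `-1 = a * (-a) / a²`. -/
theorem HasNoSemirealExtension.exists_linearOrder {K : Type*} [Field K] [IsSemireal K]
    (hK : HasNoSemirealExtension K) : ∃ _ : LinearOrder K, IsStrictOrderedRing K := by
  classical
  let C : RingCone K :=
    { Subsemiring.sumSq K with
      eq_zero_of_mem_of_neg_mem' := by
        intro a ha hna
        by_contra h0
        have ha' : IsSumSq a := by simpa using ha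
        have hna' : IsSumSq (-a) := by simpa using hna
        refine IsSemireal.not_isSumSq_neg_one K ?_
        have h1 : (-1 : K) = a * (-a) * (a⁻¹ * a⁻¹) := by field_simp
        rw [h1]
        exact (ha'.mul hna').mul (IsSumSq.mul_self _) }
  have hC : HasMemOrNegMem C := ⟨fun a => by
    have h1 : ∀ x, x ∈ C ↔ IsSumSq x := fun x => Subsemiring.mem_sumSq
    rw [h1, h1]
    exact hK.isSumSq_or_isSumSq_neg a⟩
  let : LinearOrder K := .mkOfAddGroupCone C
  have := IsOrderedRing.mkOfCone C
  exact ⟨inferInstance, IsOrderedRing.toIsStrictOrderedRing K⟩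

/-- Every semireal field embeds in an ordered field without semireal extensions. -/
theorem exists_ringHom_hasNoSemirealExtension (k : Type u) [Field k] [IsSemireal k] :
    ∃ (S : Type u) (_ : Field S) (_ : LinearOrder S) (_ : IsStrictOrderedRing S) (_ : k →+* S),
      HasNoSemirealExtension S := by
  let Ω := AlgebraicClosure k
  obtain ⟨L, hL⟩ : ∃ L : IntermediateField k Ω, 
      Maximal (fun L : IntermediateField k Ω => IsSemireal L) L := by
    -- An equation `1 + s = 0` in the union involves finitely many squares, so it already holds in a
    -- member of the chain.
    refine zorn_le₀ {L : IntermediateField k Ω | IsSemireal L} fun c hc hchain => ?_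
    rcases c.eq_empty_or_nonempty with rfl | hne
    · exact ⟨⊥, IsSemireal.of_ringHom (botEquiv k Ω).toAlgHom.toRingHom, by simp⟩
    refine ⟨sSup c, ⟨fun {s} hs h => ?_⟩, fun L => le_sSup⟩
    have hmem : ∀ x : ↥(sSup c), ∃ L ∈ c, (x : Ω) ∈ L := by
      rintro ⟨x, hx⟩
      have := hne.to_subtype
      rw [← SetLike.mem_coe, sSup_eq_iSup', coe_iSup_of_directed hchain.directedOn.directed_val] at hx
      simpa using hx
    have key : ∃ L ∈ c, ∃ t : L, IsSumSq t ∧ (t : Ω) = s := by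
      clear h
      induction hs with
      | zero => exact ⟨hne.some, hne.some_mem, 0, .zero, rfl⟩
      | @sq_add a s _ ih =>
        obtain ⟨L₁, h₁, t, ht, hts⟩ := ih
        obtain ⟨L₂, h₂, ha⟩ := hmem a
        obtain ⟨L, hL, hL₁, hL₂⟩ := hchain.directedOn _ h₁ _ h₂
        refine ⟨L, hL, ⟨a, hL₂ ha⟩ * ⟨a, hL₂ ha⟩ + inclusion hL₁ t,
          .sq_add _ (ht.map_ringHom (inclusion hL₁).toRingHom), ?_⟩
        simp [hts]
    obtain ⟨L, hLc, t, ht, hts⟩ := key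
    have : IsSemireal L := hc hLc
    refine IsSemireal.one_add_ne_zero ht ?_
    apply Subtype.ext
    simpa [hts] using congrArg (Subtype.val) h
  have hsr : IsSemireal L := hL.prop
  have hmax : HasNoSemirealExtension L := by
    intro f hf hs
    obtain ⟨α, hα⟩ := IsAlgClosed.exists_aeval_eq_zero Ω f (degree_pos_of_irreducible hf).ne'
    obtain ⟨φ⟩ := nonempty_adjoin_algHom_adjoinRoot hf hα
    have h1 : IsSemireal ((L⟮α⟯).restrictScalars k) := IsSemireal.of_ringHom φ.toRingHom
    have h2 : L ≤ (L⟮α⟯).restrictScalars k := fun x hx => (L⟮α⟯).algebraMap_mem ⟨x, hx⟩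
    have h3 : α ∈ L := hL.le_of_ge h1 h2 (mem_adjoin_simple_self L α)
    refine natDegree_eq_of_degree_eq_some (degree_eq_one_of_irreducible_of_root (x := ⟨α, h3⟩) hf ?_)
    apply (algebraMap L Ω).injective
    rw [map_zero, ← hα, ← aeval_algebraMap_apply_eq_algebraMap_eval]
    rfl
  obtain ⟨o, ho⟩ := hmax.exists_linearOrder
  exact ⟨L, inferInstance, o, ho, algebraMap k L, hmax⟩

end RealClosedFields

/-! ### Rolle's theorem and transfer of roots between ordered fields. -/

section RootTransfer

open Polynomial

theorem Polynomial.exists_mul_of_isRoot {K : Type*} [Field K] {f : K[X]} {a : K}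
    (h : f.eval a = 0) : ∃ g, f = (X - C a) * g :=
  dvd_iff_isRoot.mpr h

theorem HasPolynomialIVT.pos_of_pos {K : Type*} [Field K] [LinearOrder K] [IsStrictOrderedRing K]
    (hK : HasPolynomialIVT K) {g : K[X]} {x y : K} (h : ∀ z ∈ Set.uIcc x y, g.eval z ≠ 0)
    (hx : 0 < g.eval x) : 0 < g.eval y := by
  by_contra hy
  rw [not_lt] at hy
  rcases le_total x y with hxy | hxy
  · obtain ⟨c, h1, h2, h3⟩ := hK (-g) x y hxy (by simpa using hx.le) (by simpa using hy)
    exact h c (by rw [Set.uIcc_of_le hxy]; exact ⟨h1, h2⟩) (by simpa using h3)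
  · obtain ⟨c, h1, h2, h3⟩ := hK g y x hxy hy hx.le
    exact h c (by rw [Set.uIcc_of_ge hxy]; exact ⟨h1, h2⟩) h3

theorem HasPolynomialIVT.mul_pos {K : Type*} [Field K] [LinearOrder K] [IsStrictOrderedRing K]
    (hK : HasPolynomialIVT K) {g : K[X]} {x y : K} (h : ∀ z ∈ Set.uIcc x y, g.eval z ≠ 0) :
    0 < g.eval x * g.eval y := by
  rcases (h x Set.left_mem_uIcc).lt_or_gt with hx | hx
  · have := hK.pos_of_pos (g := -g) (x := x) (y := y) (by simpa using h) (by simpa using hx)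
    exact mul_pos_of_neg_of_neg hx (by simpa using this)
  · exact _root_.mul_pos hx (hK.pos_of_pos h hx)

/-- Rolle's theorem for two simple roots. -/
theorem HasPolynomialIVT.exists_root_derivative {K : Type*} [Field K] [LinearOrder K]
    [IsStrictOrderedRing K] (hK : HasPolynomialIVT K) {f : K[X]} (hf : f ≠ 0)
    (hsimple : ∀ x, f.eval x = 0 → f.derivative.eval x ≠ 0) {a b : K} (hab : a < b)
    (ha : f.eval a = 0) (hb : f.eval b = 0) : ∃ c, a < c ∧ c < b ∧ f.derivative.eval c = 0 := by
  -- `c` is the first root after `a`. With both roots split off, the cofactor keeps its sign on `[a,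
  -- c]`, so `f'` has opposite signs at `a` and `c`.
  obtain ⟨c, hc, hmin⟩ := Finset.exists_min_image (f.roots.toFinset.filter (a < ·)) id
    ⟨b, by simp [hf, hb, hab]⟩
  simp only [Finset.mem_filter, Multiset.mem_toFinset, mem_roots hf, IsRoot.def, id] at hc hmin
  obtain ⟨hc0, hac⟩ := hc
  have hcb : c ≤ b := hmin b ⟨hb, hab⟩
  obtain ⟨g, rfl⟩ := exists_mul_of_isRoot ha
  have hgc : g.eval c = 0 := by
    simpa [(sub_pos.mpr hac).ne'] using hc0
  obtain ⟨k, rfl⟩ := exists_mul_of_isRoot hgc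
  have hda := hsimple a ha
  have hdc := hsimple c hc0
  simp only [derivative_mul, derivative_sub, derivative_X, derivative_C, sub_zero, one_mul,
    eval_add, eval_mul, eval_sub, eval_X, eval_C, sub_self, zero_mul, add_zero, zero_add] at hda hdc
  have hpos : 0 < k.eval a * k.eval c := by
    refine hK.mul_pos fun z hz hz0 => ?_
    rw [Set.uIcc_of_le hac.le] at hz
    rcases hz.1.eq_or_lt with rfl | h1
    · simp [hz0] at hda
    rcases hz.2.eq_or_lt with rfl | h2
    · simp [hz0] at hdc
    exact h2.not_ge (hmin z ⟨by simp [hz0], h1⟩)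
  have hneg : ((X - C a) * ((X - C c) * k)).derivative.eval a *
      ((X - C a) * ((X - C c) * k)).derivative.eval c < 0 := by
    simp only [derivative_mul, derivative_sub, derivative_X, derivative_C, sub_zero, one_mul,
      eval_add, eval_mul, eval_sub, eval_X, eval_C, sub_self, zero_mul, add_zero, zero_add]
    have h1 : (a - c) * k.eval a * ((c - a) * k.eval c) =
      -((c - a) * (c - a) * (k.eval a * k.eval c)) := by ring
    have h2 := sub_pos.mpr hac
    rw [h1, neg_lt_zero]
    positivity
  by_contra hno
  push Not at hno
  refine hneg.asymm (hK.mul_pos fun z hz hz0 => ?_)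
  rw [Set.uIcc_of_le hac.le] at hz
  rcases hz.1.eq_or_lt with rfl | h1
  · exact hsimple _ ha hz0
  rcases hz.2.eq_or_lt with rfl | h2
  · exact hsimple _ hc0 hz0
  exact hno z h1 (h2.trans_le hcb) hz0

theorem Polynomial.abs_root_le {K : Type*} [Field K] [LinearOrder K] [IsStrictOrderedRing K]
    {f : K[X]} (hf : f.Monic) {x : K} (hx : f.eval x = 0) :
    |x| ≤ 1 + ∑ k ∈ Finset.range f.natDegree, |f.coeff k| := by
  by_contra! h
  have hs : 0 ≤ ∑ k ∈ Finset.range f.natDegree, |f.coeff k| := by positivity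
  have h1 : 1 ≤ |x| := by linarith
  have hn : f.natDegree ≠ 0 := by
    intro h0
    rw [hf.natDegree_eq_zero.mp h0] at hx
    simp at hx
  obtain ⟨n, hn⟩ := Nat.exists_eq_succ_of_ne_zero hn
  rw [eval_eq_sum_range, Finset.sum_range_succ, hf.coeff_natDegree, one_mul] at hx
  have h2 : |x| ^ f.natDegree ≤ (∑ k ∈ Finset.range f.natDegree, |f.coeff k|) * |x| ^ n := by
    rw [← abs_pow, show x ^ f.natDegree = -∑ k ∈ Finset.range f.natDegree, f.coeff k * x ^ k by
      linear_combination hx, abs_neg, Finset.sum_mul]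
    refine (Finset.abs_sum_le_sum_abs _ _).trans (Finset.sum_le_sum fun k hk => ?_)
    rw [abs_mul, abs_pow]
    rw [Finset.mem_range, hn] at hk
    exact mul_le_mul_of_nonneg_left (pow_le_pow_right₀ h1 (by omega)) (abs_nonneg _)
  have h4 : |x| ^ f.natDegree = |x| * |x| ^ n := by rw [hn, pow_succ']
  rw [h4] at h2
  have h3 : 0 < |x| ^ n := by positivity
  have := le_of_mul_le_mul_right h2 h3
  linarith

/-- A root of `f` is isolated by two points of a subfield containing all roots of `f'`, and
the position of the root with respect to these is determined by the signs of `f`. -/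
theorem HasPolynomialIVT.sign_of_isolated {S : Type*} [Field S] [LinearOrder S]
    [IsStrictOrderedRing S] (hS : HasPolynomialIVT S) {f : S[X]} (hf : f ≠ 0)
    (hsimple : ∀ x, f.eval x = 0 → f.derivative.eval x ≠ 0) {a b α : S} (haα : a < α) (hαb : α < b)
    (hα : f.eval α = 0) (hd : ∀ x, a < x → x < b → f.derivative.eval x ≠ 0)
    (hfa : f.eval a ≠ 0) (hfb : f.eval b ≠ 0) {c : S} (hac : a ≤ c) (hcb : c ≤ b) :
    0 < f.eval c * f.eval b ↔ α < c := by
  have hroot : ∀ x, a ≤ x → x ≤ b → f.eval x = 0 → x = α := by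
    intro x hax hxb hx
    rcases lt_trichotomy x α with h | h | h
    · obtain ⟨y, h1, h2, h3⟩ := hS.exists_root_derivative hf hsimple h hx hα
      exact absurd h3 (hd y (hax.trans_lt h1) (h2.trans hαb))
    · exact h
    · obtain ⟨y, h1, h2, h3⟩ := hS.exists_root_derivative hf hsimple h hα hx
      exact absurd h3 (hd y (haα.trans h1) (h2.trans_le hxb))
  obtain ⟨g, rfl⟩ := exists_mul_of_isRoot hα
  have hg : 0 < g.eval c * g.eval b := by
    refine hS.mul_pos fun z hz hz0 => ?_
    rw [Set.uIcc_of_le hcb] at hz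
    have := hroot z (hac.trans hz.1) hz.2 (by simp [hz0])
    subst this
    exact hsimple z hα (by simp [hz0])
  have h1 : ((X - C α) * g).eval c * ((X - C α) * g).eval b =
      (c - α) * ((b - α) * (g.eval c * g.eval b)) := by simp; ring
  rw [h1, mul_pos_iff_of_pos_right (_root_.mul_pos (sub_pos.mpr hαb) hg), sub_pos]

variable {E S T : Type*} [Field E] [LinearOrder E] [IsStrictOrderedRing E]
  [Field S] [LinearOrder S] [IsStrictOrderedRing S]
  [Field T] [LinearOrder T] [IsStrictOrderedRing T]

/-- Two elements realizing the same cut give the same signs to polynomials whose roots lie in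
the base field. -/
theorem eval₂_pos_of_same_cut (hS : HasPolynomialIVT S) (hT : HasPolynomialIVT T) {i : E →+* S}
    {j : E →+* T} (hi : StrictMono i) (hj : StrictMono j) {n : ℕ}
    (hSn : ∀ g : E[X], g ≠ 0 → g.natDegree < n → ∀ x, g.eval₂ i x = 0 → ∃ e, i e = x)
    (hTn : ∀ g : E[X], g ≠ 0 → g.natDegree < n → ∀ x, g.eval₂ j x = 0 → ∃ e, j e = x)
    {α : S} {β : T} (hlt : ∀ c, i c < α → j c < β) (hgt : ∀ c, α < i c → β < j c) (g : E[X])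
    (hg : g.natDegree < n) (hpos : 0 < g.eval₂ i α) : 0 < g.eval₂ j β := by
  induction h : g.natDegree using Nat.strong_induction_on generalizing g with
  | h m ih =>
  subst h
  have hg0 : g ≠ 0 := by rintro rfl; simp at hpos
  -- A root in `E` splits off a linear factor, whose sign the cut determines. Without one, `g` has
  -- no root in `S` or `T` either, so its sign is constant and can be read off at `0`.
  by_cases hr : ∃ e, g.eval e = 0
  · obtain ⟨e, he⟩ := hr
    obtain ⟨k, rfl⟩ := exists_mul_of_isRoot he
    rw [mul_ne_zero_iff] at hg0
    have hdeg : ((X - C e) * k).natDegree = k.natDegree + 1 := by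
      rw [natDegree_mul hg0.1 hg0.2, natDegree_X_sub_C, add_comm]
    simp only [eval₂_mul, eval₂_sub, eval₂_X, eval₂_C] at hpos ⊢
    rcases mul_pos_iff.mp hpos with ⟨h1, h2⟩ | ⟨h1, h2⟩
    · exact _root_.mul_pos (sub_pos.mpr (hlt e (sub_pos.mp h1)))
        (ih k.natDegree (by omega) k (by omega) h2 rfl)
    · refine mul_pos_of_neg_of_neg (sub_neg.mpr (hgt e (sub_neg.mp h1))) ?_
      have := ih (-k).natDegree (by rw [natDegree_neg]; omega) (-k) (by rw [natDegree_neg]; omega)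
        (by simpa using h2) rfl
      simpa using this
  · push Not at hr
    have h1 : ∀ x, (g.map i).eval x ≠ 0 := fun x hx => by
      rw [Polynomial.eval_map] at hx
      obtain ⟨e, rfl⟩ := hSn g hg0 hg x hx
      rw [eval₂_at_apply, map_eq_zero] at hx
      exact hr e hx
    have h2 : ∀ x, (g.map j).eval x ≠ 0 := fun x hx => by
      rw [Polynomial.eval_map] at hx
      obtain ⟨e, rfl⟩ := hTn g hg0 hg x hx
      rw [eval₂_at_apply, map_eq_zero] at hx
      exact hr e hx
    rw [← Polynomial.eval_map] at hpos ⊢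
    have h3 := hS.pos_of_pos (y := i 0) (fun z _ => h1 z) hpos
    rw [Polynomial.eval_map, eval₂_at_apply, ← map_zero i, hi.lt_iff_lt] at h3
    refine hT.pos_of_pos (x := j 0) (fun z _ => h2 z) ?_
    rw [Polynomial.eval_map, eval₂_at_apply, ← map_zero j, hj.lt_iff_lt]
    exact h3

/-- The Cauchy bound on roots is an expression in the coefficients, so it comes from `E`. -/
theorem exists_map_lt_root {i : E →+* S} (hi : StrictMono i) {f : E[X]} (hf : f ≠ 0) {α : S}
    (hα : f.eval₂ i α = 0) : ∃ M, i (-M) < α ∧ α < i M := by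
  have habs : ∀ x, |i x| = i |x| := fun x => by
    rcases le_total 0 x with h | h
    · rw [abs_of_nonneg h, abs_of_nonneg (by simpa using hi.monotone h)]
    · rw [abs_of_nonpos h, abs_of_nonpos (by simpa using hi.monotone h), map_neg]
  have h1 := abs_root_le ((monic_mul_leadingCoeff_inv hf).map i) (x := α)
    (by rw [Polynomial.eval_map, eval₂_mul, hα, zero_mul])
  simp only [coeff_map, habs, ← map_sum, ← map_one i, ← map_add] at h1
  refine ⟨_, by rw [map_neg]; exact (abs_lt.mp (h1.trans_lt (hi (lt_add_one _)))).1,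
    (abs_lt.mp (h1.trans_lt (hi (lt_add_one _)))).2⟩

/-- An irreducible polynomial, such that all roots of polynomials of lower degree lie in
the base field, has a root in `T` realizing the same cut as a given root in `S`. -/
theorem exists_root_same_sign (hS : HasPolynomialIVT S) (hT : HasPolynomialIVT T) {i : E →+* S}
    {j : E →+* T} (hi : StrictMono i) (hj : StrictMono j) {f : E[X]} (hf : Irreducible f)
    (hf2 : 2 ≤ f.natDegree)
    (hSn : ∀ g : E[X], g ≠ 0 → g.natDegree < f.natDegree → ∀ x, g.eval₂ i x = 0 → ∃ e, i e = x)
    (hTn : ∀ g : E[X], g ≠ 0 → g.natDegree < f.natDegree → ∀ x, g.eval₂ j x = 0 → ∃ e, j e = x)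
    {α : S} (hα : f.eval₂ i α = 0) :
    ∃ β, f.eval₂ j β = 0 ∧
      ∀ g : E[X], g.natDegree < f.natDegree → (0 < g.eval₂ i α ↔ 0 < g.eval₂ j β) := by
  have hroot : ∀ e, f.eval e ≠ 0 := fun e he => by
    have : f.natDegree = 1 :=
      natDegree_eq_of_degree_eq_some (degree_eq_one_of_irreducible_of_root hf he)
    omega
  have hdd : f.derivative.natDegree < f.natDegree := natDegree_derivative_lt (by lia)
  have hd0 : f.derivative ≠ 0 := fun h => by
    have := derivative_eq_zero.mp h
    omega
  have hcop : IsCoprime f f.derivative := hf.separable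
  have hSs : ∀ x, (f.map i).eval x = 0 → (f.map i).derivative.eval x ≠ 0 := fun x h1 h2 => by
    obtain ⟨u, v, huv⟩ := hcop
    rw [derivative_map] at h2
    have := congrArg (eval₂ i x) huv
    rw [Polynomial.eval_map] at h1 h2
    simp [h1, h2] at this
  have hTs : ∀ x, (f.map j).eval x = 0 → (f.map j).derivative.eval x ≠ 0 := fun x h1 h2 => by
    obtain ⟨u, v, huv⟩ := hcop
    rw [derivative_map] at h2
    have := congrArg (eval₂ j x) huv
    rw [Polynomial.eval_map] at h1 h2
    simp [h1, h2] at this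
  have hαE : ∀ e, i e ≠ α := by
    rintro e rfl
    rw [eval₂_at_apply, map_eq_zero] at hα
    exact hroot e hα
  obtain ⟨M, hM1, hM2⟩ := exists_map_lt_root hi hf.ne_zero hα
  classical
  -- `a` and `b` will be the neighbours of `α` in `B`. As `f'` has lower degree than `f`, its roots
  -- in `S` and `T` come from `E`, so it has none between `a` and `b` in either field.
  let B : Finset E := f.derivative.roots.toFinset ∪ {-M, M}
  obtain ⟨a, ha, hamax⟩ := Finset.exists_max_image (B.filter (i · < α)) id ⟨-M, by simpa [B] using hM1⟩
  obtain ⟨b, hb, hbmin⟩ := Finset.exists_min_image (B.filter (α < i ·)) id ⟨M, by simp [B, hM2]⟩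
  simp only [Finset.mem_filter, id] at ha hamax hb hbmin
  have hab : a < b := hi.lt_iff_lt.mp (ha.2.trans hb.2)
  have hE : ∀ e, a < e → e < b → f.derivative.eval e ≠ 0 := by
    intro e h1 h2 h0
    have heB : e ∈ B := by simp [B, hd0, h0]
    rcases (hαE e).lt_or_gt with h | h
    · exact h1.not_ge (hamax e ⟨heB, h⟩)
    · exact h2.not_ge (hbmin e ⟨heB, h⟩)
  have hmap : ∀ e, (f.map i).eval (i e) = i (f.eval e) := fun e => by
    rw [Polynomial.eval_map, eval₂_at_apply]
  have hmapj : ∀ e, (f.map j).eval (j e) = j (f.eval e) := fun e => by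
    rw [Polynomial.eval_map, eval₂_at_apply]
  have hsgnS : ∀ c, a ≤ c → c ≤ b → (0 < f.eval c * f.eval b ↔ α < i c) := by
    intro c hac hcb
    rw [← hS.sign_of_isolated (f := f.map i) (Polynomial.map_ne_zero hf.ne_zero) hSs ha.2 hb.2
      (by rwa [Polynomial.eval_map]) ?_ (by simp [hmap, hroot]) (by simp [hmap, hroot])
      (hi.monotone hac) (hi.monotone hcb), hmap, hmap, ← map_mul, ← map_zero i, hi.lt_iff_lt]
    intro x h1 h2 h0
    rw [derivative_map, Polynomial.eval_map] at h0
    obtain ⟨e, rfl⟩ := hSn _ hd0 hdd x h0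
    rw [eval₂_at_apply, map_eq_zero] at h0
    exact hE e (hi.lt_iff_lt.mp h1) (hi.lt_iff_lt.mp h2) h0
  have hfab : f.eval a * f.eval b < 0 := by
    have h1 : ¬ 0 < f.eval a * f.eval b := by
      rw [hsgnS a le_rfl hab.le]; exact ha.2.not_gt
    exact lt_of_le_of_ne (not_lt.mp h1) (mul_ne_zero (hroot a) (hroot b))
  obtain ⟨β, haβ, hβb, hβ⟩ : ∃ β, j a < β ∧ β < j b ∧ (f.map j).eval β = 0 := by
    have key : ∃ β, j a ≤ β ∧ β ≤ j b ∧ (f.map j).eval β = 0 := by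
      rcases mul_neg_iff.mp hfab with ⟨h1, h2⟩ | ⟨h1, h2⟩
      · obtain ⟨β, h3, h4, h5⟩ := hT (-(f.map j)) (j a) (j b) (hj.monotone hab.le)
          (by simpa [hmapj] using hj.monotone h1.le) (by simpa [hmapj] using hj.monotone h2.le)
        exact ⟨β, h3, h4, by simpa using h5⟩
      · exact hT (f.map j) (j a) (j b) (hj.monotone hab.le)
          (by simpa [hmapj] using hj.monotone h1.le) (by simpa [hmapj] using hj.monotone h2.le)
    obtain ⟨β, h1, h2, h3⟩ := key
    refine ⟨β, lt_of_le_of_ne h1 ?_, lt_of_le_of_ne h2 ?_, h3⟩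
    · rintro rfl
      rw [hmapj, map_eq_zero] at h3
      exact hroot a h3
    · rintro rfl
      rw [hmapj, map_eq_zero] at h3
      exact hroot b h3
  have hβE : ∀ e, j e ≠ β := by
    rintro e rfl
    rw [hmapj, map_eq_zero] at hβ
    exact hroot e hβ
  have hsgnT : ∀ c, a ≤ c → c ≤ b → (0 < f.eval c * f.eval b ↔ β < j c) := by
    intro c hac hcb
    rw [← hT.sign_of_isolated (f := f.map j) (Polynomial.map_ne_zero hf.ne_zero) hTs haβ hβb hβ
      ?_ (by simp [hmapj, hroot]) (by simp [hmapj, hroot])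
      (hj.monotone hac) (hj.monotone hcb), hmapj, hmapj, ← map_mul, ← map_zero j, hj.lt_iff_lt]
    intro x h1 h2 h0
    rw [derivative_map, Polynomial.eval_map] at h0
    obtain ⟨e, rfl⟩ := hTn _ hd0 hdd x h0
    rw [eval₂_at_apply, map_eq_zero] at h0
    exact hE e (hj.lt_iff_lt.mp h1) (hj.lt_iff_lt.mp h2) h0
  have hcut : ∀ c, α < i c ↔ β < j c := by
    intro c
    rcases le_or_gt c a with h | h
    · exact iff_of_false ((hi.monotone h).trans ha.2.le).not_gt
        ((hj.monotone h).trans haβ.le).not_gt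
    rcases le_or_gt b c with h' | h'
    · exact iff_of_true (hb.2.trans_le (hi.monotone h')) (hβb.trans_le (hj.monotone h'))
    · rw [← hsgnS c h.le h'.le, hsgnT c h.le h'.le]
  have hcut' : ∀ c, i c < α ↔ j c < β := by
    intro c
    rw [← (hαE c).le_iff_lt, ← (hβE c).le_iff_lt, ← not_lt, ← not_lt, hcut]
  exact ⟨β, by rwa [← Polynomial.eval_map], fun g hg =>
    ⟨eval₂_pos_of_same_cut hS hT hi hj hSn hTn (fun c => (hcut' c).mp) (fun c => (hcut c).mp) g hg,
      eval₂_pos_of_same_cut hT hS hj hi hTn hSn (fun c => (hcut' c).mpr) (fun c => (hcut c).mpr)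
        g hg⟩⟩

end RootTransfer

/-! ### Extending order embeddings along algebraic extensions. -/

section OrderedExtension

open Polynomial IntermediateField

/-- The minimal polynomial of `x` has degree below `n`, so `h` forces it to be linear. -/
theorem mem_range_of_root_of_natDegree_lt {L A : Type*} [Field L] [Field A] {i : L →+* A} {n : ℕ}
    (h : ∀ f : L[X], Irreducible f → 2 ≤ f.natDegree → f.natDegree < n → ∀ x, f.eval₂ i x ≠ 0)
    (g : L[X]) (hg : g ≠ 0) (hgn : g.natDegree < n) (x : A) (hx : g.eval₂ i x = 0) :
    ∃ e, i e = x := by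
  let := i.toAlgebra
  have hint : IsIntegral L x := IsAlgebraic.isIntegral ⟨g, hg, hx⟩
  have hle := natDegree_le_natDegree (minpoly.min L x (p := g * C g.leadingCoeff⁻¹)
    (monic_mul_leadingCoeff_inv hg) (by rw [aeval_mul, aeval_def, RingHom.algebraMap_toAlgebra, hx,
      zero_mul]))
  rw [natDegree_mul_leadingCoeff_inv g hg] at hle
  by_contra hne
  have h2 : 2 ≤ (minpoly L x).natDegree := (minpoly.two_le_natDegree_iff hint).mpr hne
  exact h _ (minpoly.irreducible hint) h2 (hle.trans_lt hgn) x (minpoly.aeval L x)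

/-- Zorn's lemma gives a maximal order-preserving partial embedding. If its domain were not `S`,
`exists_root_same_sign` would extend it by a root of matching sign behaviour. -/
theorem nonempty_algHom_of_hasPolynomialIVT {K S T : Type*} [Field K] [LinearOrder K]
    [IsStrictOrderedRing K] [Field S] [LinearOrder S] [IsStrictOrderedRing S]
    [Field T] [LinearOrder T] [IsStrictOrderedRing T] [Algebra K S] [Algebra K T]
    [Algebra.IsAlgebraic K S] (hKS : StrictMono (algebraMap K S))
    (hKT : StrictMono (algebraMap K T)) (hS : HasPolynomialIVT S) (hT : HasPolynomialIVT T) :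
    Nonempty (S →ₐ[K] T) := by
  obtain ⟨σ, hσ⟩ : ∃ σ : Lifts K S T,
      Maximal (fun σ : Lifts K S T => ∀ x : σ.carrier, 0 < (x : S) → 0 < σ.emb x) σ := by
    have hbot : ∀ x : (⊥ : Lifts K S T).carrier, 0 < (x : S) → 0 < (⊥ : Lifts K S T).emb x := by
      rintro ⟨x, hx⟩ hpos
      obtain ⟨y, rfl⟩ := mem_bot.mp hx
      have h1 : (⊥ : Lifts K S T).emb ⟨algebraMap K S y, hx⟩ = algebraMap K T y :=
        (⊥ : Lifts K S T).emb.commutes y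
      rw [h1, ← map_zero (algebraMap K T), hKT.lt_iff_lt]
      rwa [← map_zero (algebraMap K S), hKS.lt_iff_lt] at hpos
    refine zorn_le₀ {σ : Lifts K S T | ∀ x : σ.carrier, 0 < (x : S) → 0 < σ.emb x}
      fun c hc hchain => ⟨Lifts.union c hchain, ?_, Lifts.le_union c hchain⟩
    rintro ⟨x, hx⟩ hpos
    -- `Lifts.union` is the supremum over `insert ⊥ c`, which also covers the empty chain.
    have hins : IsChain (· ≤ ·) (insert ⊥ c) := hchain.insert fun _ _ _ => .inl bot_le
    have hmem : ∃ τ ∈ insert ⊥ c, x ∈ τ.carrier := by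
      have h1 : (Lifts.union c hchain).carrier = ⨆ τ : ↑(insert ⊥ c), τ.val.carrier := rfl
      rw [h1, ← SetLike.mem_coe, coe_iSup_of_directed (t := fun τ : ↑(insert ⊥ c) => τ.val.carrier)
        (hins.directedOn.directed_val.mono_comp _ fun _ _ h => h.1)] at hx
      simpa using hx
    obtain ⟨τ, hτ, hxτ⟩ := hmem
    have hle : τ ≤ Lifts.union c hchain := by
      rcases hτ with rfl | hτ
      · exact bot_le
      · exact Lifts.le_union c hchain hτ
    have hτpos : 0 < τ.emb ⟨x, hxτ⟩ := by
      rcases hτ with rfl | hτ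
      · exact hbot _ hpos
      · exact hc hτ _ hpos
    rwa [← hle.2] at hτpos
  by_cases htop : σ.carrier = ⊤
  · exact ⟨σ.emb.comp <| ((equivOfEq htop).trans topEquiv).symm⟩
  exfalso
  let L := σ.carrier
  have hi : StrictMono (algebraMap L S) := fun x y h => h
  have hj : StrictMono (σ.emb : L →+* T) := fun x y h => by
    have := hσ.prop (y - x) (sub_pos.mpr h)
    rwa [map_sub, sub_pos] at this
  -- Roots in `T` are admitted too: root transfer needs all roots of lower degree to come from `L`
  -- in both fields, and the minimal `n` then ensures this.
  let P : ℕ → Prop := fun n => ∃ f : L[X], Irreducible f ∧ 2 ≤ f.natDegree ∧ f.natDegree = n ∧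
    ((∃ α, f.eval₂ (algebraMap L S) α = 0) ∨ ∃ β, f.eval₂ (σ.emb : L →+* T) β = 0)
  have halg : Algebra.IsAlgebraic L S := .tower_top (K := K) L
  have hP : ∃ n, P n := by
    obtain ⟨α, -, hα⟩ := SetLike.exists_of_lt (lt_top_iff_ne_top.mpr htop)
    have hint : IsIntegral L α := (Algebra.IsAlgebraic.isAlgebraic α).isIntegral
    refine ⟨_, minpoly L α, minpoly.irreducible hint, ?_, rfl, .inl ⟨α, minpoly.aeval L α⟩⟩
    rw [minpoly.two_le_natDegree_iff hint]
    rintro ⟨y, rfl⟩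
    exact hα y.2
  classical
  obtain ⟨f, hf, hf2, hfn, hroot⟩ := Nat.find_spec hP
  have hSn := mem_range_of_root_of_natDegree_lt (n := f.natDegree) (i := algebraMap L S)
    fun g hg hg2 hgn x hx => Nat.find_min hP (hfn ▸ hgn) ⟨g, hg, hg2, rfl, .inl ⟨x, hx⟩⟩
  have hTn := mem_range_of_root_of_natDegree_lt (n := f.natDegree) (i := (σ.emb : L →+* T))
    fun g hg hg2 hgn x hx => Nat.find_min hP (hfn ▸ hgn) ⟨g, hg, hg2, rfl, .inr ⟨x, hx⟩⟩
  obtain ⟨α, β, hα, hβ, hαβ⟩ : ∃ (α : S) (β : T), f.eval₂ (algebraMap L S) α = 0 ∧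
      f.eval₂ (σ.emb : L →+* T) β = 0 ∧ ∀ g : L[X], g.natDegree < f.natDegree →
        (0 < g.eval₂ (algebraMap L S) α ↔ 0 < g.eval₂ (σ.emb : L →+* T) β) := by
    rcases hroot with ⟨α, hα⟩ | ⟨β, hβ⟩
    · obtain ⟨β, hβ, h⟩ := exists_root_same_sign hS hT hi hj hf hf2 hSn hTn hα
      exact ⟨α, β, hα, hβ, h⟩
    · obtain ⟨α, hα, h⟩ := exists_root_same_sign hT hS hj hi hf hf2 hTn hSn hβ
      exact ⟨α, β, hα, hβ, fun g hg => (h g hg).symm⟩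
  have hint : IsIntegral L α := (Algebra.IsAlgebraic.isAlgebraic α).isIntegral
  have hmin := minpoly.eq_of_irreducible hf hα
  have hαL : α ∉ L := fun hmem => by
    have h1 : f.natDegree = 1 := natDegree_eq_of_degree_eq_some
      (degree_eq_one_of_irreducible_of_root (x := ⟨α, hmem⟩) hf <| by
        apply (algebraMap L S).injective
        rw [map_zero, ← hα, ← eval₂_at_apply]
        rfl)
    omega
  let : Algebra L T := (σ.emb : L →+* T).toAlgebra
  let N := L⟮α⟯.restrictScalars K
  let : Algebra L N := L⟮α⟯.toSubalgebra.algebra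
  let φ : N →ₐ[L] T := (algHomAdjoinIntegralEquiv L hint).symm ⟨β, by
    rw [mem_aroots, ← hmin]
    refine ⟨hmin ▸ minpoly.ne_zero hint, ?_⟩
    rw [aeval_mul, aeval_def, RingHom.algebraMap_toAlgebra, hβ, zero_mul]⟩
  let τ : Lifts K S T := ⟨N, (@algHomEquivSigma K L N T _ _ _ _ _ _ _ _
      (IsScalarTower.of_algebraMap_eq fun _ ↦ rfl)).symm ⟨σ.emb, φ⟩⟩
  have hle : σ ≤ τ := ⟨fun z hz ↦ IntermediateField.algebraMap_mem L⟮α⟯ ⟨z, hz⟩, φ.commutes⟩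
  -- Elements of `L(α)` are values at `α` of polynomials of degree below that of `f`, and these have
  -- equal signs at `α` and `β`.
  have hτpos : ∀ x : τ.carrier, 0 < (x : S) → 0 < τ.emb x := by
    intro x hx
    obtain ⟨g, hg, hgx⟩ := (adjoin.powerBasis hint).exists_eq_aeval (x : L⟮α⟯)
    rw [adjoin.powerBasis_dim, ← hmin, natDegree_mul_leadingCoeff_inv f hf.ne_zero] at hg
    rw [adjoin.powerBasis_gen] at hgx
    have hxα : (x : S) = g.eval₂ (algebraMap L S) α := by
      have := congrArg (algebraMap L⟮α⟯ S) hgx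
      rw [← aeval_algebraMap_apply, AdjoinSimple.algebraMap_gen] at this
      exact this
    have hxβ : τ.emb x = g.eval₂ (σ.emb : L →+* T) β := by
      have h1 : τ.emb x = φ x := rfl
      have h2 : φ (AdjoinSimple.gen L α) = β := algHomAdjoinIntegralEquiv_symm_apply_gen L hint _
      have h3 : φ x = φ (aeval (AdjoinSimple.gen L α) g) := congrArg φ hgx
      rw [h1, h3, ← h2]
      exact (aeval_algHom_apply φ _ g).symm
    rw [hxβ, ← hαβ g hg, ← hxα]
    exact hx
  exact hαL ((hσ.le_of_ge hτpos hle).1 (mem_adjoin_simple_self L α))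

end OrderedExtension

/-! ### Ultrapowers, the Artin-Lang theorem and the real Nullstellensatz. -/

section ArtinLang

open Polynomial IntermediateField Filter

theorem Filter.Germ.eval_map_coeRingHom {ι F : Type*} [CommRing F] (l : Filter ι) (f : (ι → F)[X])
    (a : ι → F) : (f.map (Germ.coeRingHom l)).eval (a : Germ l F) =
      ((fun s => (f.map (Pi.evalRingHom (fun _ => F) s)).eval (a s) : ι → F) : Germ l F) := by
  have h1 : (a : Germ l F) = Germ.coeRingHom l a := rfl
  rw [h1, eval_map_apply]
  refine congrArg (fun g : ι → F => (g : Germ l F)) (funext fun s => ?_)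
  exact (eval_map_apply (Pi.evalRingHom (fun _ => F) s) a).symm

/-- An instance of Łoś's theorem: the inequalities hold at almost all indices, and roots are chosen
there index by index. -/
theorem HasPolynomialIVT.germ {ι F : Type*} [Field F] [LinearOrder F]
    (hF : HasPolynomialIVT F) (U : Ultrafilter ι) : HasPolynomialIVT (Germ (U : Filter ι) F) := by
  intro f a b hab ha hb
  obtain ⟨f, rfl⟩ := Polynomial.map_surjective (Germ.coeRingHom (U : Filter ι))
    (fun x => x.inductionOn fun y => ⟨y, rfl⟩) f
  induction a using Germ.inductionOn with | _ a
  induction b using Germ.inductionOn with | _ b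
  rw [Germ.eval_map_coeRingHom] at ha hb
  have ha' := Germ.coe_le.mp ha
  have hb' := Germ.coe_le.mp hb
  have hab' := Germ.coe_le.mp hab
  have h : ∀ᶠ s in (U : Filter ι), ∃ c, a s ≤ c ∧ c ≤ b s ∧
      (f.map (Pi.evalRingHom (fun _ => F) s)).eval c = 0 := by
    filter_upwards [ha', hb', hab'] with s h1 h2 h3
    exact hF _ _ _ h3 h1 h2
  obtain ⟨c, hc⟩ := h.choice
  refine ⟨(c : Germ (U : Filter ι) F), Germ.coe_le.mpr (hc.mono fun s hs => hs.1),
    Germ.coe_le.mpr (hc.mono fun s hs => hs.2.1), ?_⟩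
  rw [Germ.eval_map_coeRingHom]
  exact Germ.coe_eq.mpr (hc.mono fun s hs => hs.2.2)

/-- A homomorphism from a finitely generated algebra to an ultrapower of `F` yields one to `F`. -/
theorem nonempty_algHom_of_germ {R A F ι : Type*} [Field R] [CommRing A] [Algebra R A]
    [Algebra.FiniteType R A] [CommRing F] [Algebra R F] {l : Filter ι} [l.NeBot]
    (φ : A →+* Germ l F) (hφ : ∀ r, φ (algebraMap R A r) = ((algebraMap R F r : F) : Germ l F)) :
    Nonempty (A →ₐ[R] F) := by
  obtain ⟨n, π, hπ, ⟨s, hs⟩⟩ := (Algebra.FinitePresentation.of_finiteType (R := R) (A := A)).mp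
    inferInstance
  choose a ha using fun k => Quotient.exists_rep (φ (π (MvPolynomial.X k)))
  let ev : MvPolynomial (Fin n) R →ₐ[R] (ι → F) := MvPolynomial.aeval a
  have hev : ∀ p, ((ev p : ι → F) : Germ l F) = φ (π p) := by
    have h : (Germ.coeRingHom l).comp ev.toRingHom = φ.comp π.toRingHom := by
      refine MvPolynomial.ringHom_ext (fun r => ?_) (fun k => ?_)
      · have h1 : π (MvPolynomial.C r) = algebraMap R A r := π.commutes r
        have h2 : ev (MvPolynomial.C r) = algebraMap R (ι → F) r := ev.commutes r
        simp only [RingHom.comp_apply, AlgHom.toRingHom_eq_coe, RingHom.coe_coe, h1, h2, hφ]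
        rfl
      · simp only [RingHom.comp_apply, AlgHom.toRingHom_eq_coe, RingHom.coe_coe]
        rw [← ha k]
        simp only [ev, MvPolynomial.aeval_X]
        rfl
    exact fun p => RingHom.congr_fun h p
  -- There are finitely many defining relations, so a single index satisfies all of them.
  have hzero : ∀ᶠ i in l, ∀ p ∈ s, ev p i = 0 := by
    rw [Filter.eventually_all_finset]
    intro p hp
    have h1 : π p = 0 := by
      have : p ∈ RingHom.ker π.toRingHom := hs ▸ Ideal.subset_span hp
      exact this
    have h2 := hev p
    rw [h1, map_zero] at h2
    exact Germ.coe_eq.mp h2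
  obtain ⟨i, hi⟩ := hzero.exists
  have hker : ∀ p, π p = 0 → ev p i = 0 := by
    have h1 : Ideal.span (s : Set (MvPolynomial (Fin n) R)) ≤
        RingHom.ker ((Pi.evalAlgHom R (fun _ => F) i).comp ev) :=
      Ideal.span_le.mpr fun p hp => hi p hp
    intro p hp
    exact h1 (hs.symm ▸ hp)
  exact ⟨AlgHom.liftOfSurjective π hπ ((Pi.evalAlgHom R (fun _ => F) i).comp ev)
    (fun p hp => hker p hp)⟩

variable {R S : Type u} [Field R] [Field S] [LinearOrder S]
  [Algebra R S]

theorem HasPolynomialIVT.of_algebraicallyClosedIn {K : Type*} [Field K] [Algebra K S]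
    (hS : HasPolynomialIVT S) {F : IntermediateField K S}
    (hF : ∀ x : S, IsAlgebraic F x → x ∈ F) : HasPolynomialIVT F := by
  intro f a b hab ha hb
  by_cases h0 : f = 0
  · exact ⟨a, le_rfl, hab, by simp [h0]⟩
  have hev : ∀ x : F, (f.map (algebraMap F S)).eval (x : S) = (f.eval x : F) := fun x =>
    eval_map_apply (algebraMap F S) x
  obtain ⟨c, h1, h2, h3⟩ := hS (f.map (algebraMap F S)) a b hab (by rw [hev]; exact ha)
    (by rw [hev]; exact hb)
  have hc : c ∈ F := hF c ⟨f, h0, by rwa [aeval_def, ← Polynomial.eval_map]⟩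
  refine ⟨⟨c, hc⟩, h1, h2, Subtype.ext ?_⟩
  rw [← hev]
  exact h3

variable [IsStrictOrderedRing S]

/-- Roots in `S` of nonzero polynomials over `F` lie in `F`. An `a` in `F` on the same side as `t`
of the finitely many roots involved has no sign change between itself and `t`. -/
theorem exists_mem_same_signs {F : IntermediateField R S} (hS : HasPolynomialIVT S)
    (hF : ∀ x : S, IsAlgebraic F x → x ∈ F) {t : S} (ht : t ∉ F) (s : Finset F[X]) :
    ∃ a : F, ∀ h ∈ s, 0 < aeval t h → 0 < h.eval a := by
  classical
  let B : Finset F := s.biUnion fun h => h.roots.toFinset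
  obtain ⟨a, ha1, ha2⟩ := Order.exists_between_finsets (B.filter fun e : F => (e : S) < t)
    (B.filter fun e : F => t < (e : S)) fun x hx y hy => by
      simp only [Finset.mem_filter] at hx hy
      exact hx.2.trans hy.2
  refine ⟨a, fun h hs hpos => ?_⟩
  have h0 : h ≠ 0 := by rintro rfl; simp at hpos
  have key : 0 < (h.map (algebraMap F S)).eval (a : S) := by
    refine hS.pos_of_pos (x := t) (fun z hz hz0 => ?_) (by rwa [Polynomial.eval_map])
    have hzF : z ∈ F := hF z ⟨h, h0, by rwa [aeval_def, ← Polynomial.eval_map]⟩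
    have hzB : (⟨z, hzF⟩ : F) ∈ B := by
      simp only [B, Finset.mem_biUnion]
      refine ⟨h, hs, ?_⟩
      rw [Multiset.mem_toFinset, mem_roots h0]
      apply (algebraMap F S).injective
      rw [map_zero, ← hz0]
      exact (eval_map_apply (algebraMap F S) (⟨z, hzF⟩ : F)).symm
    rcases lt_trichotomy z t with hzt | rfl | hzt
    · have h1 : z < a := ha1 ⟨z, hzF⟩ (by simp [hzB, hzt])
      exact (lt_min hzt h1).not_ge hz.1
    · exact ht hzF
    · have h1 : (a : S) < z := ha2 ⟨z, hzF⟩ (by simp [hzB, hzt])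
      exact (max_lt hzt h1).not_ge hz.2
  have h1 : (h.map (algebraMap F S)).eval (a : S) = (h.eval a : F) :=
    eval_map_apply (algebraMap F S) a
  rwa [h1] at key

/-- The simple transcendental extension `F(t)` embeds, as an ordered field, in an ultrapower
of `F`. -/
theorem exists_strictMono_adjoin_germ {F : IntermediateField R S} (hS : HasPolynomialIVT S)
    (hF : ∀ x : S, IsAlgebraic F x → x ∈ F) {t : S} (ht : t ∉ F) :
    ∃ (U : Ultrafilter (Finset F[X])) (ψ : F⟮t⟯ →+* Germ (U : Filter (Finset F[X])) F),
      StrictMono ψ ∧ ∀ y : F, ψ (algebraMap F F⟮t⟯ y) = (y : Germ (U : Filter (Finset F[X])) F) := by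
  have htr : Transcendental F t := fun h => ht (hF t h)
  choose a ha using exists_mem_same_signs hS hF ht
  -- Each polynomial lies in all sufficiently large `s`, so the germ of `a` gives it the sign it has
  -- at `t`.
  let U : Ultrafilter (Finset F[X]) := Ultrafilter.of atTop
  let c : F →+* Germ (U : Filter (Finset F[X])) F :=
    (Germ.coeRingHom _).comp (Pi.constRingHom _ F)
  let ev : F[X] →+* Germ (U : Filter (Finset F[X])) F :=
    eval₂RingHom c (a : Germ (U : Filter (Finset F[X])) F)
  have hev : ∀ h : F[X], ev h = ((fun s => h.eval (a s) : Finset F[X] → F) : Germ _ F) := by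
    intro h
    have h1 := Germ.eval_map_coeRingHom (U : Filter (Finset F[X])) (h.map (Pi.constRingHom _ F)) a
    rw [Polynomial.map_map, Polynomial.eval_map] at h1
    refine h1.trans (congrArg _ (funext fun s => ?_))
    rw [Polynomial.map_map]
    exact congrArg (Polynomial.eval (a s)) (Polynomial.map_id)
  have hpos : ∀ h : F[X], 0 < aeval t h → 0 < ev h := by
    intro h ht
    rw [hev]
    refine Germ.coe_pos.mpr ?_
    have h1 : ∀ᶠ s in (atTop : Filter (Finset F[X])), 0 < h.eval (a s) := by
      filter_upwards [eventually_ge_atTop {h}] with s hs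
      exact ha s h (hs (Finset.mem_singleton_self h)) ht
    exact Ultrafilter.of_le _ h1
  have hinj : Function.Injective ev := by
    rw [injective_iff_map_eq_zero]
    intro h h0
    by_contra hne
    have hne' : aeval t h ≠ 0 := fun h' => htr ⟨h, hne, h'⟩
    rcases hne'.lt_or_gt with h1 | h1
    · have := hpos (-h) (by simpa using h1)
      simp [h0] at this
    · exact (hpos h h1).ne' h0
  let e := RatFunc.algEquivOfTranscendental t htr
  let ψ₀ : RatFunc F →+* Germ (U : Filter (Finset F[X])) F := IsFractionRing.lift hinj
  have hψ₀ : ∀ h : F[X], ψ₀ (algebraMap F[X] (RatFunc F) h) = ev h :=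
    fun h => IsFractionRing.lift_algebraMap hinj h
  refine ⟨U, ψ₀.comp e.symm.toRingHom, ?_, fun y => ?_⟩
  · have hmain : ∀ x : F⟮t⟯, 0 < x → 0 < ψ₀ (e.symm x) := by
      intro x hx
      obtain ⟨u, rfl⟩ := e.surjective x
      rw [e.symm_apply_apply]
      have hx' : (0 : S) < (e u : F⟮t⟯) := hx
      obtain ⟨p, q, hq, rfl⟩ := IsFractionRing.div_surjective (A := F[X]) u
      have hq0 : q ≠ 0 := nonZeroDivisors.ne_zero hq
      have hval : ∀ h : F[X], ((e (algebraMap F[X] (RatFunc F) h) : F⟮t⟯) : S) = aeval t h :=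
        fun h => by
          rw [RatFunc.algEquivOfTranscendental_algebraMap]
          change algebraMap F⟮t⟯ S _ = _
          rw [← aeval_algebraMap_apply, AdjoinSimple.algebraMap_gen]
      rw [map_div₀, IntermediateField.coe_div, hval, hval] at hx'
      rw [map_div₀, hψ₀, hψ₀, div_pos_iff, ← mul_pos_iff, ← map_mul]
      apply hpos
      rwa [map_mul, mul_pos_iff, ← div_pos_iff]
    intro x y hxy
    have := hmain (y - x) (sub_pos.mpr hxy)
    rw [map_sub, map_sub, sub_pos] at this
    exact this
  · have h1 : e.symm (algebraMap F F⟮t⟯ y) = algebraMap F[X] (RatFunc F) (C y) := by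
      rw [AlgEquiv.commutes]; rfl
    change ψ₀ (e.symm (algebraMap F F⟮t⟯ y)) = _
    rw [h1, hψ₀]
    simp only [ev, coe_eval₂RingHom, eval₂_C]
    rfl

/-- An intermediate field that is algebraically closed in `S`, such that every finitely
generated `R`-algebra with a point in it has an `R`-point. -/
structure IsSpecializable (F : IntermediateField R S) : Prop where
  mem_of_isAlgebraic : ∀ x : S, IsAlgebraic F x → x ∈ F
  nonempty_algHom : ∀ (A : Type u) [CommRing A] [Algebra R A] [Algebra.FiniteType R A],
    (A →ₐ[R] F) → Nonempty (A →ₐ[R] R)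

/-- An element of `S` algebraic over `R` generates a semireal extension of `R`, which is trivial. -/
theorem IsSpecializable.bot [IsRealClosed R] : IsSpecializable (⊥ : IntermediateField R S) where
  mem_of_isAlgebraic x hx := by
    have hint : IsIntegral R x := (hx.restrictScalars R).isIntegral
    have := IsSemireal.of_ringHom (AdjoinRoot.liftAlgHom (minpoly R x) (Algebra.ofId R S) x
      (minpoly.aeval R x)).toRingHom
    have h1 := IsRealClosed.hasNoSemirealExtension R _ (minpoly.irreducible hint) this
    exact mem_bot.mpr (minpoly.natDegree_eq_one_iff.mp h1)
  nonempty_algHom A _ _ _ φ := ⟨(botEquiv R S).toAlgHom.comp φ⟩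

/-- `F'` is the algebraic closure of `F(t)` in `S`. It embeds in an ultrapower of `F`, so a point in
`F'` yields one in `F`. -/
theorem IsSpecializable.exists_mem (hS : HasPolynomialIVT S) {F : IntermediateField R S}
    (hF : IsSpecializable F) (t : S) :
    ∃ F' : IntermediateField R S, IsSpecializable F' ∧ F ≤ F' ∧ t ∈ F' := by
  by_cases ht : t ∈ F
  · exact ⟨F, hF, le_rfl, ht⟩
  obtain ⟨U, ψ, hψ, hψF⟩ := exists_strictMono_adjoin_germ hS hF.mem_of_isAlgebraic ht
  have hFI : HasPolynomialIVT F := hS.of_algebraicallyClosedIn hF.mem_of_isAlgebraic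
  let C := algebraicClosure F⟮t⟯ S
  have hC : ∀ x : S, IsAlgebraic C x → x ∈ C := fun x hx =>
    (mem_algebraicClosure_iff).mpr (hx.restrictScalars F⟮t⟯)
  let : Algebra F⟮t⟯ (Germ (U : Filter (Finset F[X])) F) := ψ.toAlgebra
  obtain ⟨χ⟩ := nonempty_algHom_of_hasPolynomialIVT (K := F⟮t⟯) (S := C)
    (T := Germ (U : Filter (Finset F[X])) F) (fun x y h => h) hψ
    (hS.of_algebraicallyClosedIn hC) (hFI.germ U)
  refine ⟨(C.restrictScalars F).restrictScalars R, ⟨hC, fun A _ _ _ φ => ?_⟩, fun x hx => ?_, ?_⟩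
  · let φ' : A →+* C := φ.toRingHom
    obtain ⟨θ⟩ := nonempty_algHom_of_germ (R := R) (F := F) (χ.toRingHom.comp φ') fun r => by
      have h1 : φ' (algebraMap R A r) =
          algebraMap F⟮t⟯ C (algebraMap F F⟮t⟯ (algebraMap R F r)) := φ.commutes r
      have h2 : χ (algebraMap F⟮t⟯ C (algebraMap F F⟮t⟯ (algebraMap R F r))) =
        ψ (algebraMap F F⟮t⟯ (algebraMap R F r)) := χ.commutes _
      rw [← hψF, ← h2, ← h1]
      rfl
    exact hF.nonempty_algHom A θ
  · exact C.algebraMap_mem (algebraMap F F⟮t⟯ ⟨x, hx⟩)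
  · exact C.algebraMap_mem (AdjoinSimple.gen F t)

/-- The Artin-Lang homomorphism theorem. -/
theorem IsRealClosed.nonempty_algHom [IsRealClosed R] (hS : HasPolynomialIVT S) {A : Type u}
    [CommRing A] [Algebra R A] [Algebra.FiniteType R A] (φ : A →ₐ[R] S) :
    Nonempty (A →ₐ[R] R) := by
  classical
  have key : ∀ s : Finset S, ∃ F : IntermediateField R S, IsSpecializable F ∧ (s : Set S) ⊆ F := by
    intro s
    induction s using Finset.induction_on with
    | empty => exact ⟨⊥, .bot, by simp⟩
    | insert t s _ ih =>
      obtain ⟨F, hF, hs⟩ := ih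
      obtain ⟨F', hF', hle, ht⟩ := hF.exists_mem hS t
      refine ⟨F', hF', ?_⟩
      rw [Finset.coe_insert, Set.insert_subset_iff]
      exact ⟨ht, hs.trans hle⟩
  obtain ⟨s, hs⟩ := (Algebra.FiniteType.out : (⊤ : Subalgebra R A).FG)
  obtain ⟨F, hF, hsF⟩ := key (s.image φ)
  have hle : φ.range ≤ F.toSubalgebra := by
    rw [← Algebra.map_top, ← hs, AlgHom.map_adjoin, Algebra.adjoin_le_iff]
    simpa using hsF
  exact hF.nonempty_algHom A (φ.codRestrict F.toSubalgebra fun x => hle ⟨x, rfl⟩)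

/-- The weak real Nullstellensatz. -/
theorem IsRealClosed.isSumSq_neg_one_of_isEmpty [IsRealClosed R] {A : Type u} [CommRing A]
    [Algebra R A] [Algebra.FiniteType R A] (h : IsEmpty (A →ₐ[R] R)) : IsSumSq (-1 : A) := by
  by_contra hA
  have := IsSemireal.of_not_isSumSq_neg_one hA
  obtain ⟨k, _, φ, _⟩ := exists_ringHom_semireal_field A
  obtain ⟨S, _, _, _, ι, hS⟩ := exists_ringHom_hasNoSemirealExtension k
  let : Algebra R S := ((ι.comp φ).comp (algebraMap R A)).toAlgebra
  obtain ⟨θ⟩ := IsRealClosed.nonempty_algHom (R := R) (S := S) hS.hasPolynomialIVT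
    (A := A) { ι.comp φ with commutes' := fun r => rfl }
  exact h.false θ

end ArtinLang

/-! ### Sums of squares, ideals and idempotents. -/

/-- `hI` says that `I` is a real ideal: the elements squared in `f` all lie in `I`, so their squares
lie in `I * I`. -/
theorem Ideal.mem_mul_self_of_isSumSq {A : Type*} [CommRing A] {I : Ideal A}
    (hI : ∀ a s : A, IsSumSq s → a * a + s ∈ I → a ∈ I) {f : A} (hf : IsSumSq f) (hfI : f ∈ I) :
    f ∈ I * I := by
  induction hf with
  | zero => exact Submodule.zero_mem _
  | @sq_add a s hs ih =>
    have ha := hI a s hs hfI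
    refine add_mem (Ideal.mul_mem_mul ha ha) (ih ?_)
    have := I.sub_mem hfI (I.mul_mem_left a ha)
    rwa [add_sub_cancel_left] at this

theorem RingHom.exists_isSumSq_lift {A B : Type*} [CommRing A] [CommRing B] {φ : A →+* B}
    (hφ : Function.Surjective φ) {s : B} (hs : IsSumSq s) : ∃ t, IsSumSq t ∧ φ t = s := by
  induction hs with
  | zero => exact ⟨0, .zero, map_zero φ⟩
  | sq_add b _ ih =>
    obtain ⟨t, ht, rfl⟩ := ih
    obtain ⟨a, rfl⟩ := hφ b
    exact ⟨a * a + t, .sq_add _ ht, by simp⟩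

/-- Sums of squares in a product of rings, where `-1` is a sum of squares in one factor. -/
theorem IsIdempotentElem.isSumSq {A : Type*} [CommRing A] {e f s : A} (he : IsIdempotentElem e)
    (h2 : IsUnit (2 : A)) (h : IsSumSq (-1 : A ⧸ Ideal.span {e})) (hs : IsSumSq s)
    (hes : e * (f - s) = 0) : IsSumSq f := by
  obtain ⟨t, ht, ht1⟩ := RingHom.exists_isSumSq_lift Ideal.Quotient.mk_surjective h
  have h3 : t + 1 ∈ Ideal.span {e} := by
    rw [← Ideal.Quotient.eq_zero_iff_mem, map_add, ht1, map_one, neg_add_cancel]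
  obtain ⟨d, hd⟩ := Ideal.mem_span_singleton'.mp h3
  obtain ⟨c, hc⟩ := h2.exists_right_inv
  have he' : e * e = e := he
  have h4 : (1 - e) * t = -(1 - e) := by linear_combination (e - 1) * hd - d * he'
  -- Here `c = 1/2`. Where `e = 1` this reads `f = s`; where `e = 0` we have `t = -1`, and it reads
  -- `f = ((f+1)/2)² - ((f-1)/2)²`.
  have h5 : f = e * e * s + (1 - e) * (1 - e) * ((f + 1) * c * ((f + 1) * c)) +
      (1 - e) * (1 - e) * t * ((f - 1) * c * ((f - 1) * c)) := by
    have h6 : (1 - e) * (1 - e) * t = -(1 - e) := by linear_combination (1 - e) * h4 - he'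
    have h7 : (1 - e) * (1 - e) = 1 - e := by linear_combination he'
    rw [h6, h7, he']
    linear_combination hes - (1 - e) * f * (1 + 2 * c) * hc
  rw [h5]
  exact (((IsSumSq.mul_self e).mul hs).add ((IsSumSq.mul_self _).mul (IsSumSq.mul_self _))).add
    (((IsSumSq.mul_self _).mul ht).mul (IsSumSq.mul_self _))

/-! ### Rational points of affine schemes and regular functions. -/

namespace RealVariety

variable {k : Type u} [Field k] {V : Scheme.{u}} {π : V ⟶ Spec (.of k)}

/-- Evaluation at a point as a ring homomorphism. -/
noncomputable def Points.evalHom (P : Points π) : Γ(V, ⊤) →+* k :=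
  (P.1.appTop ≫ (Scheme.ΓSpecIso (.of k)).hom).hom

theorem Points.evalHom_apply (P : Points π) (f : Γ(V, ⊤)) : P.evalHom f = P.eval f := rfl

theorem Points.toSpace_mem_basicOpen (P : Points π) (f : Γ(V, ⊤)) :
    P.toSpace ∈ V.basicOpen f ↔ P.eval f ≠ 0 := by
  have h1 : P.toSpace ∈ V.basicOpen f ↔
      IsLocalRing.closedPoint k ∈ P.1 ⁻¹ᵁ V.basicOpen f := Iff.rfl
  rw [h1, Scheme.preimage_basicOpen_top, basicOpen_eq_of_affine']
  change ¬ (P.eval f ∈ IsLocalRing.maximalIdeal k) ↔ _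
  rw [IsLocalRing.mem_maximalIdeal, mem_nonunits_iff, isUnit_iff_ne_zero, not_not]

variable (π) in
/-- The ring homomorphism defining the `k`-algebra structure of the regular functions. -/
noncomputable def structureHom : k →+* Γ(V, ⊤) :=
  ((Scheme.ΓSpecIso (.of k)).inv ≫ π.appTop).hom

theorem finiteType_structureHom [IsAffine V] [LocallyOfFiniteType π] :
    (structureHom π).FiniteType := by
  have h1 := HasRingHomProperty.appTop @LocallyOfFiniteType π inferInstance
  have h2 : (Scheme.ΓSpecIso (.of k)).inv.hom.FiniteType :=
    RingHom.FiniteType.of_surjective _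
      (ConcreteCategory.bijective_of_isIso (Scheme.ΓSpecIso (.of k)).inv).2
  exact h1.comp h2

theorem exists_points_eval_eq [IsAffine V] (θ : Γ(V, ⊤) →+* k)
    (hθ : θ.comp (structureHom π) = RingHom.id k) : ∃ P : Points π, ∀ f, P.eval f = θ f := by
  let P : Spec (.of k) ⟶ V := Spec.map (CommRingCat.ofHom θ) ≫ V.isoSpec.inv
  have hinv : V.isoSpec.inv.appTop = (Scheme.ΓSpecIso Γ(V, ⊤)).inv := by
    have h1 : V.isoSpec.inv.appTop ≫ V.isoSpec.hom.appTop = 𝟙 _ := by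
      rw [← Scheme.Hom.comp_appTop, Iso.hom_inv_id, Scheme.Hom.id_appTop]
    rw [Scheme.isoSpec_hom, Scheme.toSpecΓ_appTop] at h1
    exact (Iso.comp_hom_eq_id _).mp h1
  have hP : P.appTop ≫ (Scheme.ΓSpecIso (.of k)).hom = CommRingCat.ofHom θ := by
    rw [Scheme.Hom.comp_appTop, hinv, Category.assoc, Scheme.ΓSpecIso_naturality]
    exact Iso.inv_hom_id_assoc (Scheme.ΓSpecIso Γ(V, ⊤)) _
  have hθ' : (Scheme.ΓSpecIso (.of k)).inv ≫ π.appTop ≫ CommRingCat.ofHom θ = 𝟙 _ := by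
    ext1
    exact hθ
  refine ⟨⟨P, ext_of_isAffine ?_⟩, fun f => congrArg (fun φ => φ.hom f) hP⟩
  rw [← hP, Iso.inv_comp_eq, Category.comp_id, ← Category.assoc] at hθ'
  rw [Scheme.Hom.comp_appTop, Scheme.Hom.id_appTop]
  rw [← cancel_mono (Scheme.ΓSpecIso (.of k)).hom, hθ', Category.id_comp]

theorem Points.evalHom_comp_structureHom (P : Points π) :
    P.evalHom.comp (structureHom π) = RingHom.id k := by
  have h : (structureHom π : k →+* Γ(V, ⊤)) =
    ((Scheme.ΓSpecIso (.of k)).inv ≫ π.appTop).hom := rfl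
  rw [Points.evalHom, h, ← CommRingCat.hom_comp]
  have h1 : π.appTop ≫ P.1.appTop = 𝟙 _ := by
    rw [← Scheme.Hom.comp_appTop, P.2, Scheme.Hom.id_appTop]
  rw [Category.assoc, reassoc_of% h1, Iso.inv_hom_id]
  rfl

/-- Restricting a point of a subscheme. -/
theorem exists_points_comp {W : Scheme.{u}} (ι : W ⟶ V) (Q : Points (ι ≫ π)) :
    ∃ P : Points π, ∀ f, P.eval f = Q.eval (ι.appTop f) :=
  ⟨⟨Q.1 ≫ ι, by rw [Category.assoc, Q.2]⟩, fun f => by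
    exact congrArg (fun φ : Γ(V, ⊤) ⟶ Γ(Spec (.of k), ⊤) => (Scheme.ΓSpecIso (.of k)).hom (φ f))
      (Scheme.Hom.comp_appTop Q.1 ι)⟩

/-- A function that pulls back to zero on `W` vanishes at `P`, so evaluation at `P` factors through
the surjection onto the functions on `W`. -/
theorem Points.exists_lift [IsAffine V] {W : Scheme.{u}} (ι : W ⟶ V) [IsClosedImmersion ι]
    (P : Points π) (hP : P.toSpace ∈ Set.range ι) :
    ∃ Q : Points (ι ≫ π), ∀ f, Q.eval (ι.appTop f) = P.eval f := by
  obtain ⟨_, hsurj⟩ := IsClosedImmersion.isAffine_surjective_of_isAffine ι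
  have hker : RingHom.ker ι.appTop.hom ≤ RingHom.ker P.evalHom := by
    intro f hf
    rw [RingHom.mem_ker] at hf ⊢
    rw [Points.evalHom_apply]
    by_contra hne
    obtain ⟨x, hx⟩ := hP
    have h1 : x ∈ ι ⁻¹ᵁ V.basicOpen f := by
      have := (P.toSpace_mem_basicOpen f).mpr hne
      rwa [← hx] at this
    rw [Scheme.preimage_basicOpen_top] at h1
    erw [hf] at h1
    rw [Scheme.basicOpen_zero] at h1
    exact h1
  let θ : Γ(W, ⊤) →+* k := RingHom.liftOfSurjective ι.appTop.hom hsurj ⟨P.evalHom, hker⟩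
  have hθ : ∀ f, θ (ι.appTop f) = P.eval f :=
    fun f => RingHom.liftOfSurjective_comp_apply ι.appTop.hom hsurj ⟨P.evalHom, hker⟩ f
  obtain ⟨Q, hQ⟩ := exists_points_eval_eq (π := ι ≫ π) θ (by
    rw [← P.evalHom_comp_structureHom]
    ext r
    have h1 : structureHom (ι ≫ π) r = ι.appTop (structureHom π r) := by
      rw [structureHom, Scheme.Hom.comp_appTop]; rfl
    rw [RingHom.comp_apply, h1, hθ]
    rfl)
  exact ⟨Q, fun f => (hQ _).trans (hθ f)⟩

/-- If the ideal of `V(k)` is generated by `e`, then the Zariski closure of `V(k)` is the zero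
locus of `e`. -/
theorem closure_rationalPoints_eq_compl_basicOpen [IsAffine V] {e : Γ(V, ⊤)}
    (he : ∀ f : Γ(V, ⊤), (∀ P : Points π, P.eval f = 0) ↔ ∃ g, g * e = f) :
    closure (rationalPoints π) = (V.basicOpen e : Set V)ᶜ := by
  apply Set.Subset.antisymm
  · refine closure_minimal ?_ (V.basicOpen e).isOpen.isClosed_compl
    rintro _ ⟨P, rfl⟩ hP
    exact (P.toSpace_mem_basicOpen e).mp hP ((he e).mpr ⟨1, one_mul e⟩ P)
  · intro x hx
    by_contra hxc
    obtain ⟨_, ⟨_, ⟨f, rfl⟩, rfl⟩, hxf, hfs⟩ := (isBasis_basicOpen V).exists_subset_of_mem_open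
      (hxc : x ∈ (closure (rationalPoints π))ᶜ) isClosed_closure.isOpen_compl
    have hf : ∀ P : Points π, P.eval f = 0 := by
      intro P
      by_contra hne
      exact hfs ((P.toSpace_mem_basicOpen f).mpr hne) (subset_closure ⟨P, rfl⟩)
    obtain ⟨g, rfl⟩ := (he f).mp hf
    rw [Scheme.basicOpen_mul] at hxf
    exact hx hxf.2

theorem isOpen_compl_basicOpen {e : Γ(V, ⊤)} (he : IsIdempotentElem e) :
    IsOpen (V.basicOpen e : Set V)ᶜ := by
  have h : (V.basicOpen e : Set V)ᶜ = V.basicOpen (1 - e) := by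
    apply Set.Subset.antisymm
    · intro x hx
      have h1 : x ∈ V.basicOpen (e + (1 - e)) := by
        rw [add_sub_cancel, Scheme.basicOpen_of_isUnit _ isUnit_one]
        trivial
      rcases Scheme.basicOpen_add_le V e (1 - e) h1 with h2 | h2
      · exact absurd h2 hx
      · exact h2
    · intro x hx hx'
      have h1 : x ∈ V.basicOpen (e * (1 - e)) := by
        rw [Scheme.basicOpen_mul]; exact ⟨hx', hx⟩
      rw [he.mul_one_sub_self, Scheme.basicOpen_zero] at h1
      exact h1
  rw [h]
  exact (V.basicOpen (1 - e)).isOpen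

theorem exists_isIdempotentElem_basicOpen_eq [IsAffine V] {Z : Set V} (hZ : IsClopen Z) :
    ∃ e : Γ(V, ⊤), IsIdempotentElem e ∧ Z = V.basicOpen e := by
  have h1 : IsClopen (V.isoSpec.inv ⁻¹' Z) := hZ.preimage V.isoSpec.inv.continuous
  obtain ⟨e, he, heq⟩ := PrimeSpectrum.exists_idempotent_basicOpen_eq_of_isClopen h1
  refine ⟨e, he, ?_⟩
  rw [← Scheme.toSpecΓ_preimage_basicOpen]
  change Z = V.toSpecΓ ⁻¹' (PrimeSpectrum.basicOpen e : Set (PrimeSpectrum Γ(V, ⊤)))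
  rw [← heq, ← Set.preimage_comp, ← Scheme.isoSpec_hom]
  ext x
  have h2 : V.isoSpec.inv (V.isoSpec.hom x) = x := by
    have h3 : (V.isoSpec.hom ≫ V.isoSpec.inv) x = x := by rw [Iso.hom_inv_id]; rfl
    exact h3
  rw [Set.mem_preimage, Function.comp_apply, h2]

/-! ### Real and non-real components. -/

theorem mem_realPart_or_nonrealPart (x : V) : x ∈ realPart π ∨ x ∈ nonrealPart π := by
  have hC := irreducibleComponent_mem_irreducibleComponents x
  have hx : x ∈ irreducibleComponent x := mem_irreducibleComponent
  by_cases h : IsRealSubset π (irreducibleComponent x)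
  · exact .inl ⟨_, ⟨hC, h⟩, hx⟩
  · exact .inr ⟨_, ⟨hC, h⟩, hx⟩

/-- If the Zariski closure of `V(k)` is open, then it is the union of the real components. -/
theorem realPart_nonrealPart_of_isOpen_closure [TopologicalSpace.NoetherianSpace V]
    (ho : IsOpen (closure (rationalPoints π))) :
    realPart π = closure (rationalPoints π) ∧
      nonrealPart π = (closure (rationalPoints π))ᶜ := by
  set Z := closure (rationalPoints π) with hZ
  have hclopen : IsClopen Z := ⟨isClosed_closure, ho⟩
  have hreal : realPart π ⊆ Z := by
    rintro x ⟨C, ⟨_, hCr⟩, hx⟩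
    exact closure_mono Set.inter_subset_right (hCr hx)
  have hnonreal : nonrealPart π ⊆ Zᶜ := by
    rintro x ⟨C, ⟨hC, hCn⟩, hx⟩ hxZ
    refine hCn ?_
    have hCZ : C ⊆ Z := hC.1.isConnected.isPreconnected.subset_isClopen hclopen ⟨x, hx, hxZ⟩
    -- `o` is a nonempty subset of `C`, open in `V`. The rational points are dense in `o` because it
    -- lies in `Z`, and `o` is dense in the irreducible `C`.
    obtain ⟨o, ho, hne, hoC⟩ :=
      TopologicalSpace.NoetherianSpace.exists_isOpen_nonempty_subset_irreducibleComponent C hC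
    have h1 : C ⊆ closure o := by
      have := (isPreirreducible_iff_subset_closure_inter_open C).mp hC.1.isPreirreducible o ho
        ⟨_, hoC hne.some_mem, hne.some_mem⟩
      exact this.trans (closure_mono Set.inter_subset_right)
    refine h1.trans (closure_minimal ?_ isClosed_closure)
    have h2 : o ⊆ closure (o ∩ rationalPoints π) := fun y hy =>
      ho.inter_closure ⟨hy, hCZ (hoC hy)⟩
    exact h2.trans (closure_mono (Set.inter_subset_inter_left _ hoC))
  constructor
  · refine hreal.antisymm fun x hx => ?_
    exact (mem_realPart_or_nonrealPart x).resolve_right fun h => hnonreal h hx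
  · refine hnonreal.antisymm fun x hx => ?_
    exact (mem_realPart_or_nonrealPart x).resolve_left fun h => hx (hreal h)

theorem isClosed_nonrealPart [TopologicalSpace.NoetherianSpace V] : IsClosed (nonrealPart π) := by
  rw [nonrealPart, Set.sUnion_eq_biUnion]
  refine Set.Finite.isClosed_biUnion ?_ fun Z hZ => isClosed_of_mem_irreducibleComponents Z hZ.1
  exact TopologicalSpace.NoetherianSpace.finite_irreducibleComponents.subset fun Z hZ => hZ.1

theorem isClopen_realPart [TopologicalSpace.NoetherianSpace V] (hcl : IsClosed (realPart π))
    (h : realPart π ∩ nonrealPart π = ∅) : IsClopen (realPart π) := by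
  refine ⟨hcl, ?_⟩
  have h1 : realPart π = (nonrealPart π)ᶜ := by
    apply Set.Subset.antisymm
    · exact fun x hx hx' => (h ▸ (⟨hx, hx'⟩ : x ∈ realPart π ∩ nonrealPart π) : x ∈ (∅ : Set V))
    · exact fun x hx => (mem_realPart_or_nonrealPart x).resolve_right hx
  rw [h1]
  exact isClosed_nonrealPart.isOpen_compl

section

variable {R : Type u} [Field R] [LinearOrder R] [IsStrictOrderedRing R] {V : Scheme.{u}}
  {π : V ⟶ Spec (.of R)}

/-- If psd = sos, then the ideal of functions vanishing at all points is generated by an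
idempotent. -/
theorem PsdEqSos.exists_isIdempotentElem [IsNoetherianRing Γ(V, ⊤)] (h : PsdEqSos π) :
    ∃ e : Γ(V, ⊤), IsIdempotentElem e ∧
      ∀ f : Γ(V, ⊤), (∀ P : Points π, P.eval f = 0) ↔ ∃ g, g * e = f := by
  let I : Ideal Γ(V, ⊤) := ⨅ P : Points π, RingHom.ker P.evalHom
  have hI : ∀ f, f ∈ I ↔ ∀ P : Points π, P.eval f = 0 := fun f => by
    simp only [I, Submodule.mem_iInf, RingHom.mem_ker]
    rfl
  have hidem : IsIdempotentElem I := by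
    refine le_antisymm Ideal.mul_le_left fun f hf => ?_
    refine Ideal.mem_mul_self_of_isSumSq (fun a s hs has => ?_)
      (h f fun P => ((hI f).mp hf P).ge) hf
    rw [hI] at has ⊢
    intro P
    have h1 : P.evalHom a * P.evalHom a + P.evalHom s = 0 := by
      rw [← map_mul, ← map_add]; exact has P
    have h2 := (hs.map_ringHom P.evalHom).nonneg
    have h3 := mul_self_nonneg (P.evalHom a)
    have h4 : P.evalHom a * P.evalHom a = 0 := by linarith
    exact mul_self_eq_zero.mp h4
  obtain ⟨e, he, hIe⟩ := (Ideal.isIdempotentElem_iff_of_fg I (IsNoetherian.noetherian I)).mp hidem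
  exact ⟨e, he, fun f => by rw [← hI, hIe]; exact Ideal.mem_span_singleton'⟩

end

/-- The inclusion of the real part. -/
noncomputable def realSubvarietyι (π : V ⟶ Spec (.of k)) [IsVariety π] : realSubvariety π ⟶ V :=
  (Scheme.IdealSheafData.vanishingIdeal ⟨realPart π, isClosed_realPart π⟩).subschemeι

instance (π : V ⟶ Spec (.of k)) [IsVariety π] : IsClosedImmersion (realSubvarietyι π) :=
  inferInstanceAs (IsClosedImmersion
    (Scheme.IdealSheafData.vanishingIdeal ⟨realPart π, isClosed_realPart π⟩).subschemeι)

theorem range_realSubvarietyι (π : V ⟶ Spec (.of k)) [IsVariety π] :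
    Set.range (realSubvarietyι π) = realPart π := by
  have h := (Scheme.IdealSheafData.vanishingIdeal
    ⟨realPart π, isClosed_realPart π⟩).range_subschemeι
  rw [Scheme.IdealSheafData.coe_support_vanishingIdeal] at h
  exact h

end RealVariety

/-! ### The equivalence. -/

open RealVariety in
theorem mainTheorem11 {R : Type u} [Field R] [LinearOrder R] [IsStrictOrderedRing R]
    [IsRealClosed R] {V : Scheme.{u}} (π : V ⟶ Spec (.of R)) [RealVariety.IsVariety π]
    [IsAffine V] :
    RealVariety.PsdEqSos π ↔
      RealVariety.nonrealPart π ∩ RealVariety.rationalPoints π = ∅ ∧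
      RealVariety.realPart π ∩ RealVariety.nonrealPart π = ∅ ∧
      RealVariety.PsdEqSos (RealVariety.realSubvarietyStr π) := by
  have hft : LocallyOfFiniteType π := IsVariety.locallyOfFiniteType
  have hred : IsReduced V := IsVariety.isReduced π
  have hfin := finiteType_structureHom (π := π)
  let : Algebra R Γ(V, ⊤) := (structureHom π).toAlgebra
  have hfin' : Algebra.FiniteType R Γ(V, ⊤) := hfin
  have hnoeth : IsNoetherianRing Γ(V, ⊤) := Algebra.FiniteType.isNoetherianRing R _
  have hln : IsLocallyNoetherian V := LocallyOfFiniteType.isLocallyNoetherian π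
  have hN : IsNoetherian V := { }
  let ι : realSubvariety π ⟶ V := realSubvarietyι π
  have hrange : Set.range ι = realPart π := range_realSubvarietyι π
  have hsurj := (IsClosedImmersion.isAffine_surjective_of_isAffine ι).2
  constructor
  · intro h
    obtain ⟨e, he, heI⟩ := h.exists_isIdempotentElem
    have hcl := closure_rationalPoints_eq_compl_basicOpen heI
    have ho : IsOpen (closure (rationalPoints π)) := hcl ▸ isOpen_compl_basicOpen he
    obtain ⟨hr, hnr⟩ := realPart_nonrealPart_of_isOpen_closure ho
    refine ⟨?_, by rw [hr, hnr, Set.inter_compl_self], fun f hf => ?_⟩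
    · rw [hnr, ← Set.disjoint_iff_inter_eq_empty, Set.disjoint_compl_left_iff_subset]
      exact subset_closure
    · obtain ⟨g, rfl⟩ := hsurj f
      have hg : IsSumSq g := h g fun P => by
        obtain ⟨Q, hQ⟩ := P.exists_lift ι (by rw [hrange, hr]; exact subset_closure ⟨P, rfl⟩)
        rw [← hQ]
        exact hf Q
      exact hg.map_ringHom ι.appTop.hom
  · rintro ⟨hempty, hdisj, hsos⟩ f hf
    obtain ⟨e, he, heZ⟩ := exists_isIdempotentElem_basicOpen_eq
      (isClopen_realPart (isClosed_realPart π) hdisj)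
    have hfr : IsSumSq (ι.appTop.hom f) := hsos _ fun Q => by
      obtain ⟨P, hP⟩ := exists_points_comp (π := π) ι Q
      exact (hP f).symm ▸ hf P
    obtain ⟨s, hs, hsf⟩ := RingHom.exists_isSumSq_lift hsurj hfr
    have h2 : IsUnit (2 : Γ(V, ⊤)) := by
      have := (isUnit_iff_ne_zero.mpr (two_ne_zero (α := R))).map (structureHom π)
      rwa [map_ofNat] at this
    refine he.isSumSq h2 ?_ hs ?_
    -- An `R`-point of the quotient by `e` would be a point of V(R) where `e` vanishes, hence on
    -- V_nr.
    · refine IsRealClosed.isSumSq_neg_one_of_isEmpty (R := R) ⟨fun θ => ?_⟩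
      obtain ⟨P, hP⟩ := exists_points_eval_eq (π := π)
        (θ.toRingHom.comp (Ideal.Quotient.mk (Ideal.span {e}))) (RingHom.ext fun r => θ.commutes r)
      have hPe : P.eval e = 0 := by
        rw [hP]
        have : Ideal.Quotient.mk (Ideal.span {e}) e = 0 :=
          Ideal.Quotient.eq_zero_iff_mem.mpr (Ideal.mem_span_singleton_self e)
        rw [RingHom.comp_apply, this, map_zero]
      have hPn : P.toSpace ∈ nonrealPart π :=
        (mem_realPart_or_nonrealPart P.toSpace).resolve_left fun hmem => by
          rw [heZ] at hmem
          exact (P.toSpace_mem_basicOpen e).mp hmem hPe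
      exact (hempty ▸ (⟨hPn, P, rfl⟩ : P.toSpace ∈ nonrealPart π ∩ rationalPoints π) :
        P.toSpace ∈ (∅ : Set V))
    -- As `V` is reduced, it suffices that `e * (f - s)` is nonzero nowhere: `e` vanishes off V_r
    -- and `f - s` vanishes on it.
    · rw [← basicOpen_eq_bot_iff, Scheme.basicOpen_mul, eq_bot_iff]
      rintro x ⟨hxe, hxf⟩
      have hxr : x ∈ Set.range ι := by rw [hrange, heZ]; exact hxe
      obtain ⟨y, rfl⟩ := hxr
      have h1 : y ∈ ι ⁻¹ᵁ V.basicOpen (f - s) := hxf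
      have h3 : ι.appTop.hom (f - s) = 0 := by rw [map_sub, hsf, sub_self]
      rw [Scheme.preimage_basicOpen_top] at h1
      erw [h3] at h1
      rw [Scheme.basicOpen_zero] at h1
      exact h1
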